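/- **Theorem 0.1.** Let $(M,g)$ be an $n$-dimensional (smooth) pseudo-Riemannian manifold of index $q\in\{1,\dots,n-2\}$, and let $A\neq M$ be a closed subset of $M$. Then there exists a (smooth) semi-Riemannian metric $g'$ of index $q$ on $M$ such that - $g'=g$ on $A$, i.e. $g'_x=g_x$ for every $x\in A$; - every $g$-timelike vector $v\in TM$ (i.e. $g(v,v)<0$) is $g'$-timelike; - the open submanifold $M\setminus A$ does not admit any smooth codimension-$q$ foliation none of whose tangent vectors is $g'$-timelike. In particular, $(M,g')$ does not admit any space foliation, i.e. any smooth codimension-$q$ foliation of $M$ all of whose nonzero tangent vectors $v$ are $g'$-spacelike ($g'(v,v)>0$). -/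

import Mathlib

open scoped Manifold ContDiff

/-- A (smooth) semi-Riemannian metric of index `q` on an `n`-dimensional manifold `M`: a smooth
section of the bundle of symmetric bilinear forms on `TM` which is nondegenerate and has index `q`
at every point. The index of a symmetric bilinear form is the maximal dimension of a subspace on
which the form is negative definite; this is Mathlib's `sigNeg` of the quadratic form
`v ↦ g x v v`. -/
structure SemiRiemannianMetric (n q : ℕ) (M : Type*) [TopologicalSpace M]
    [ChartedSpace (EuclideanSpace ℝ (Fin n)) M] [IsManifold (𝓡 n) ∞ M] where
  /-- The bilinear form on the tangent space at each point. -/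
  form (x : M) : TangentSpace (𝓡 n) x →L[ℝ] TangentSpace (𝓡 n) x →L[ℝ] ℝ
  symm (x : M) (v w : TangentSpace (𝓡 n) x) : form x v w = form x w v
  nondegenerate (x : M) (v : TangentSpace (𝓡 n) x) (hv : ∀ w, form x v w = 0) : v = 0
  index_eq (x : M) :
    sigNeg (LinearMap.BilinMap.toQuadraticMap (form x).toLinearMap₁₂) = q
  contMDiff : ContMDiff (𝓡 n)
    ((𝓡 n).prod 𝓘(ℝ, EuclideanSpace ℝ (Fin n) →L[ℝ] EuclideanSpace ℝ (Fin n) →L[ℝ] ℝ)) ∞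
    (fun x ↦ Bundle.TotalSpace.mk'
      (EuclideanSpace ℝ (Fin n) →L[ℝ] EuclideanSpace ℝ (Fin n) →L[ℝ] ℝ)
      (E := fun x : M ↦ TangentSpace (𝓡 n) x →L[ℝ] TangentSpace (𝓡 n) x →L[ℝ] ℝ) x (form x))

namespace SemiRiemannianMetric

variable {n q : ℕ} {M : Type*} [TopologicalSpace M]
  [ChartedSpace (EuclideanSpace ℝ (Fin n)) M] [IsManifold (𝓡 n) ∞ M]

/-- A tangent vector `v` is timelike if `g(v, v) < 0`. -/
def IsTimelike (g : SemiRiemannianMetric n q M) {x : M} (v : TangentSpace (𝓡 n) x) : Prop :=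
  g.form x v v < 0

/-- A tangent vector `v` is spacelike if `g(v, v) > 0` (so spacelike vectors are nonzero). -/
def IsSpacelike (g : SemiRiemannianMetric n q M) {x : M} (v : TangentSpace (𝓡 n) x) : Prop :=
  0 < g.form x v v

end SemiRiemannianMetric

/-- Two points of `ℝⁿ = ℝⁿ⁻ᑫ × ℝᑫ` lie on the same horizontal slice `ℝⁿ⁻ᑫ × {t}`: their last `q`
coordinates (the transverse ones) agree. -/
def SameSlice {n : ℕ} (q : ℕ) (y z : EuclideanSpace ℝ (Fin n)) : Prop :=
  ∀ i : Fin n, n ≤ (i : ℕ) + q → y i = z i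

/-- A (smooth) codimension-`q` foliation of the open submanifold `U` of the `n`-manifold `M`, given
by a foliated atlas: a family of smooth charts of `M` whose domains are contained in `U` and cover
`U` (so `U` is open), such that all changes of charts are locally of the form
`(a, b) ↦ (α(a, b), τ(b))` with respect to `ℝⁿ = ℝⁿ⁻ᑫ × ℝᑫ`. The plaques
`φ⁻¹(ℝⁿ⁻ᑫ × {t})` are the local pieces of the leaves. -/
structure FoliationOn (n q : ℕ) {M : Type*} [TopologicalSpace M]
    [ChartedSpace (EuclideanSpace ℝ (Fin n)) M] (U : Set M) where
  /-- The foliated charts. -/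
  charts : Set (OpenPartialHomeomorph M (EuclideanSpace ℝ (Fin n)))
  mem_maximalAtlas : ∀ φ ∈ charts, φ ∈ IsManifold.maximalAtlas (𝓡 n) ∞ M
  source_subset : ∀ φ ∈ charts, φ.source ⊆ U
  covers : ∀ x ∈ U, ∃ φ ∈ charts, x ∈ φ.source
  compatible : ∀ φ ∈ charts, ∀ ψ ∈ charts, ∀ x ∈ φ.source ∩ ψ.source,
    ∃ W : Set M, IsOpen W ∧ x ∈ W ∧ W ⊆ φ.source ∩ ψ.source ∧
      ∀ y ∈ W, ∀ z ∈ W, SameSlice q (φ y) (φ z) → SameSlice q (ψ y) (ψ z)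

namespace FoliationOn

variable {n q : ℕ} {M : Type*} [TopologicalSpace M]
  [ChartedSpace (EuclideanSpace ℝ (Fin n)) M] {U : Set M}

/-- `v ∈ T_xM` is a tangent vector of the foliation, i.e. is tangent to the leaf through `x`: in a
foliated chart `φ` around `x`, the vector `dφ_x(v)` is tangent to the slice `ℝⁿ⁻ᑫ × {t}` through
`φ x`. By compatibility of the charts this does not depend on the choice of `φ`. -/
def IsTangent (F : FoliationOn n q U) {x : M} (v : TangentSpace (𝓡 n) x) : Prop :=
  ∃ φ ∈ F.charts, x ∈ φ.source ∧ SameSlice (n := n) q (mfderiv (𝓡 n) (𝓡 n) φ x v) 0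

end FoliationOn

/-- A codimension-`q` foliation on a semi-Riemannian manifold of index `q` is a space foliation if
all its nonzero tangent vectors are spacelike. -/
def SemiRiemannianMetric.IsSpaceFoliation {n q : ℕ} {M : Type*} [TopologicalSpace M]
    [ChartedSpace (EuclideanSpace ℝ (Fin n)) M] [IsManifold (𝓡 n) ∞ M]
    (g : SemiRiemannianMetric n q M) (F : FoliationOn n q (Set.univ : Set M)) : Prop :=
  ∀ (x : M) (v : TangentSpace (𝓡 n) x), F.IsTangent v → v ≠ 0 → g.IsSpacelike v

open Set Filter Topology Metric

/-! Fix `p ∉ A` and a chart at `p` with a splitting of the model space into a negative definite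
space, identified with `F = ℝ^q`, and a positive definite complement, which has dimension at least 2
because `q ≤ n - 2`. With `x`, `y` two coordinates on the complement, `z` the projection to `F` and
`e ∈ F` a unit vector, the `F`-valued form `η = dz - x dy e` has a nonintegrable kernel, positive
definite near `p`. Put `g' = g - Λ f ‖η‖²`, with `f` a bump function supported in the complement of
`A`. Subtracting a square only enlarges the light cones. It leaves `g` unchanged on `ker η` and
lowers it on the vertical space, so nondegeneracy and index `q` survive (`eq_zero_of_transverse`,
`sigNeg_eq_finrank_of_transverse`).

For large `Λ`, every non-timelike vector of the slice spanned by `x`, `y`, `z` is `ε`-close to `ker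
η` where `f = 1` (`TransverseFrame.exists_cone_bound`). A foliation without timelike tangent vectors
therefore induces on the slice a foliation by graphs over the `(x, y)`-plane, almost tangent to `dz
= x dy e`. Over a square of side `s` such a graph exists and is single-valued
(`exists_leafwise_square`), yet going round the boundary the form `x dy` accumulates `s²`, while the
errors add up to at most `4εs` (`IsClose.le_of_covers`). Taking `ε = s / 8` gives the contradiction.
-/

/-! ### Leaves of a transverse foliation as graphs. -/

/-- A foliation of an open subset of `E × F` transverse to the vertical factor `F`, given by local
submersions onto `F` with locally matching level sets. -/
structure TransverseCocycle (ι E F : Type*) [NormedAddCommGroup E] [NormedSpace ℝ E]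
    [NormedAddCommGroup F] [NormedSpace ℝ F] where
  /-- The domains of the local submersions. -/
  dom : ι → Set (E × F)
  /-- The local submersions. -/
  fn : ι → E × F → F
  isOpen_dom : ∀ i, IsOpen (dom i)
  contDiffOn : ∀ i, ContDiffOn ℝ 1 (fn i) (dom i)
  injective_vertical : ∀ i, ∀ p ∈ dom i, ∀ b : F, fderiv ℝ (fn i) p (0, b) = 0 → b = 0
  compatible : ∀ i j, ∀ p ∈ dom i ∩ dom j,
    ∃ N ∈ 𝓝 p, ∀ y ∈ N, ∀ z ∈ N, fn i y = fn i z → fn j y = fn j z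

namespace TransverseCocycle

variable {ι E F : Type*} [NormedAddCommGroup E] [NormedSpace ℝ E] [NormedAddCommGroup F]
  [NormedSpace ℝ F] (c : TransverseCocycle ι E F)

/-- The graph of `u` over `S` stays in a single leaf near `a`. -/
def LeafwiseAt (u : E → F) (S : Set E) (a : E) : Prop :=
  ContinuousWithinAt u S a ∧ ∃ i, (a, u a) ∈ c.dom i ∧
    ∀ᶠ x in 𝓝[S] a, c.fn i (x, u x) = c.fn i (a, u a)

/-- The graph of `u` over `S` is locally contained in leaves. -/
def Leafwise (u : E → F) (S : Set E) : Prop := ∀ a ∈ S, c.LeafwiseAt u S a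

variable {c}

lemma LeafwiseAt.mono {u : E → F} {S T : Set E} {a : E} (h : c.LeafwiseAt u S a) (hT : T ⊆ S) :
    c.LeafwiseAt u T a := by
  obtain ⟨h1, i, hi, h2⟩ := h
  exact ⟨h1.mono hT, i, hi, h2.filter_mono (nhdsWithin_mono a hT)⟩

lemma Leafwise.mono {u : E → F} {S T : Set E} (h : c.Leafwise u S) (hT : T ⊆ S) :
    c.Leafwise u T := fun a ha ↦ (h a (hT ha)).mono hT

lemma Leafwise.continuousOn {u : E → F} {S : Set E} (h : c.Leafwise u S) : ContinuousOn u S :=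
  fun a ha ↦ (h a ha).1

lemma Leafwise.congr {u v : E → F} {S : Set E} (h : c.Leafwise u S) (huv : EqOn v u S) :
    c.Leafwise v S := by
  intro a ha
  obtain ⟨h1, i, hi, h2⟩ := h a ha
  refine ⟨h1.congr huv (huv ha), i, by rwa [huv ha], ?_⟩
  filter_upwards [h2, self_mem_nhdsWithin] with x hx hxS
  rwa [huv hxS, huv ha]

/-- Compatibility carries constancy from one local submersion to another, so the index chosen in
`LeafwiseAt` is immaterial. -/
lemma LeafwiseAt.eventually_eq {u : E → F} {S : Set E} {a : E} (h : c.LeafwiseAt u S a) {j : ι}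
    (hj : (a, u a) ∈ c.dom j) : ∀ᶠ x in 𝓝[S] a, c.fn j (x, u x) = c.fn j (a, u a) := by
  obtain ⟨h1, i, hi, h2⟩ := h
  obtain ⟨N, hN, hc⟩ := c.compatible i j _ ⟨hi, hj⟩
  have h3 : ∀ᶠ x in 𝓝[S] a, (x, u x) ∈ N :=
    (continuousWithinAt_id.prodMk h1).eventually hN
  filter_upwards [h2, h3] with x hx hxN
  exact hc _ hxN _ (mem_of_mem_nhds hN) hx

lemma LeafwiseAt.union {u : E → F} {S T : Set E} {a : E} (hS : c.LeafwiseAt u S a)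
    (hT : c.LeafwiseAt u T a) : c.LeafwiseAt u (S ∪ T) a := by
  obtain ⟨h1, i, hi, h2⟩ := hS
  refine ⟨h1.union hT.1, i, hi, ?_⟩
  rw [nhdsWithin_union, eventually_sup]
  exact ⟨h2, hT.eventually_eq hi⟩

lemma LeafwiseAt.union_of_notMem {u : E → F} {S T : Set E} {a : E} (hS : c.LeafwiseAt u S a)
    (hT : IsClosed T) (ha : a ∉ T) : c.LeafwiseAt u (S ∪ T) a := by
  have hb : 𝓝[S ∪ T] a = 𝓝[S] a := by
    have hbot : 𝓝[T] a = ⊥ := notMem_closure_iff_nhdsWithin_eq_bot.1 (by rwa [hT.closure_eq])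
    rw [nhdsWithin_union, hbot, sup_bot_eq]
  obtain ⟨h1, i, hi, h2⟩ := hS
  refine ⟨?_, i, hi, by rwa [hb]⟩
  rwa [ContinuousWithinAt, hb]

lemma Leafwise.union {u : E → F} {S T : Set E} (hu : c.Leafwise u S) (hv : c.Leafwise u T)
    (hS : IsClosed S) (hT : IsClosed T) : c.Leafwise u (S ∪ T) := by
  intro a ha
  by_cases haS : a ∈ S
  · by_cases haT : a ∈ T
    · exact (hu a haS).union (hv a haT)
    · exact (hu a haS).union_of_notMem hT haT
  · have haT : a ∈ T := ha.resolve_left haS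
    rw [union_comm]
    exact (hv a haT).union_of_notMem hS haS

section FiniteDimensional

variable [FiniteDimensional ℝ E] [FiniteDimensional ℝ F]

/-- Injectivity on the vertical factor makes the derivative of `y ↦ (y.1, c.fn i y)` injective,
hence invertible in finite dimension; the inverse function theorem applies, and leaves become
horizontal slices. -/
lemma exists_straightening {i : ι} {p : E × F} (hp : p ∈ c.dom i) :
    ∃ Ψ : OpenPartialHomeomorph (E × F) (E × F), p ∈ Ψ.source ∧ Ψ.source ⊆ c.dom i ∧
      (∀ y, Ψ y = (y.1, c.fn i y)) ∧
      ∃ A : (E × F) ≃L[ℝ] (E × F), HasFDerivAt Ψ (A : (E × F) →L[ℝ] (E × F)) p ∧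
        ∀ v, A v = (v.1, fderiv ℝ (c.fn i) p v) := by
  have : CompleteSpace (E × F) := FiniteDimensional.complete ℝ _
  have hs : HasStrictFDerivAt (c.fn i) (fderiv ℝ (c.fn i) p) p :=
    ((c.contDiffOn i).contDiffAt ((c.isOpen_dom i).mem_nhds hp)).hasStrictFDerivAt one_ne_zero
  let B : (E × F) →L[ℝ] (E × F) :=
    (ContinuousLinearMap.fst ℝ E F).prod (fderiv ℝ (c.fn i) p)
  have hB : Function.Injective B := by
    rw [injective_iff_map_eq_zero]
    rintro ⟨a, b⟩ hab
    have h1 : a = 0 := congrArg Prod.fst hab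
    have h2 : fderiv ℝ (c.fn i) p (a, b) = 0 := congrArg Prod.snd hab
    subst h1
    rw [c.injective_vertical i p hp b h2]
    rfl
  let A : (E × F) ≃L[ℝ] (E × F) :=
    (LinearEquiv.ofInjectiveEndo (B : (E × F) →ₗ[ℝ] (E × F)) hB).toContinuousLinearEquiv
  have hA : (A : (E × F) →L[ℝ] (E × F)) = B := by ext v <;> rfl
  have hΦ : HasStrictFDerivAt (fun y : E × F ↦ (y.1, c.fn i y))
      (A : (E × F) →L[ℝ] (E × F)) p := by
    rw [hA]
    exact hasStrictFDerivAt_fst.prodMk hs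
  refine ⟨(hΦ.toOpenPartialHomeomorph _).restrOpen (c.dom i) (c.isOpen_dom i), ?_, ?_, ?_, A,
    hΦ.hasFDerivAt, fun v ↦ ?_⟩
  · exact ⟨hΦ.mem_toOpenPartialHomeomorph_source, hp⟩
  · exact fun x hx ↦ hx.2
  · exact fun y ↦ rfl
  · rfl

/-- The leaf through `p'` is the preimage of the slice at height `c.fn i p'` under the
straightening. The target contains a ball of radius `ρ` about `Ψ p`; keeping `Ψ p'` and the
horizontal displacement within `ρ / 2` makes the radius independent of `p'`. -/
lemma exists_leafwise_near {i : ι} {p : E × F} (hp : p ∈ c.dom i) :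
    ∃ δ > 0, ∀ p' ∈ ball p δ, ∃ u, c.Leafwise u (ball p'.1 δ) ∧ u p'.1 = p'.2 := by
  obtain ⟨Ψ, hpΨ, hsub, hΨ, -⟩ := c.exists_straightening hp
  obtain ⟨ρ, hρ, hball⟩ := Metric.isOpen_iff.1 Ψ.open_target _ (Ψ.map_source hpΨ)
  have hN : Ψ.source ∩ Ψ ⁻¹' ball (Ψ p) (ρ / 2) ∈ 𝓝 p :=
    inter_mem (Ψ.open_source.mem_nhds hpΨ)
      ((Ψ.continuousAt hpΨ).preimage_mem_nhds (ball_mem_nhds _ (half_pos hρ)))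
  obtain ⟨r, hr, hrN⟩ := Metric.mem_nhds_iff.1 hN
  refine ⟨min r (ρ / 2), lt_min hr (half_pos hρ), fun p' hp' ↦ ?_⟩
  obtain ⟨hp's, hp'b⟩ := hrN (ball_subset_ball (min_le_left _ _) hp')
  have hmem : ∀ x ∈ ball p'.1 (min r (ρ / 2)), (x, c.fn i p') ∈ Ψ.target := by
    intro x hx
    apply hball
    rw [mem_preimage, hΨ, hΨ, mem_ball, Prod.dist_eq, max_lt_iff] at hp'b
    rw [hΨ, mem_ball, Prod.dist_eq, max_lt_iff]
    constructor
    · have h1 : dist x p'.1 < ρ / 2 := lt_of_lt_of_le hx (min_le_right _ _)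
      have h2 := dist_triangle x p'.1 p.1
      simp only at hp'b ⊢
      linarith [hp'b.1]
    · simp only at hp'b ⊢
      linarith [hp'b.2]
  have hinv : ∀ x ∈ ball p'.1 (min r (ρ / 2)),
      Ψ.symm (x, c.fn i p') = (x, (Ψ.symm (x, c.fn i p')).2) := by
    intro x hx
    have h := Ψ.right_inv (hmem x hx)
    rw [hΨ] at h
    have h1 : (Ψ.symm (x, c.fn i p')).1 = x := congrArg Prod.fst h
    exact Prod.ext h1 rfl
  have hval : ∀ x ∈ ball p'.1 (min r (ρ / 2)),
      c.fn i (x, (Ψ.symm (x, c.fn i p')).2) = c.fn i p' := by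
    intro x hx
    have h := Ψ.right_inv (hmem x hx)
    rw [hΨ] at h
    rw [← hinv x hx]
    exact congrArg Prod.snd h
  have hp'eq : (Ψ.symm (p'.1, c.fn i p')) = p' := by
    have h := Ψ.left_inv hp's
    rwa [hΨ] at h
  refine ⟨fun x ↦ (Ψ.symm (x, c.fn i p')).2, fun a ha ↦ ⟨?_, i, ?_, ?_⟩, congrArg Prod.snd hp'eq⟩
  · have hc : ContinuousAt Ψ.symm (a, c.fn i p') := Ψ.symm.continuousAt (hmem a ha)
    have : ContinuousAt (fun x ↦ Ψ.symm (x, c.fn i p')) a :=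
      ContinuousAt.comp (f := fun x ↦ (x, c.fn i p')) hc (by fun_prop)
    exact (continuous_snd.continuousAt.comp this).continuousWithinAt
  · rw [← hinv a ha]
    exact hsub (Ψ.map_target (hmem a ha))
  · filter_upwards [self_mem_nhdsWithin] with x hx
    rw [hval x hx, hval a ha]

lemma exists_uniform_leafwise {K : Set (E × F)} (hK : IsCompact K) (hcov : K ⊆ ⋃ i, c.dom i) :
    ∃ δ > 0, ∀ p ∈ K, ∃ u, c.Leafwise u (ball p.1 δ) ∧ u p.1 = p.2 := by
  refine hK.induction_on (p := fun S ↦ ∃ δ > 0, ∀ p ∈ S, ∃ u, c.Leafwise u (ball p.1 δ) ∧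
    u p.1 = p.2) ⟨1, one_pos, by simp⟩ ?_ ?_ ?_
  · rintro S T hST ⟨δ, hδ, h⟩
    exact ⟨δ, hδ, fun p hp ↦ h p (hST hp)⟩
  · rintro S T ⟨δ, hδ, h⟩ ⟨δ', hδ', h'⟩
    refine ⟨min δ δ', lt_min hδ hδ', ?_⟩
    rintro p (hp | hp)
    · obtain ⟨u, hu, hup⟩ := h p hp
      exact ⟨u, hu.mono (ball_subset_ball (min_le_left _ _)), hup⟩
    · obtain ⟨u, hu, hup⟩ := h' p hp
      exact ⟨u, hu.mono (ball_subset_ball (min_le_right _ _)), hup⟩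
  · intro p hp
    obtain ⟨i, hi⟩ := mem_iUnion.1 (hcov hp)
    obtain ⟨δ, hδ, h⟩ := c.exists_leafwise_near hi
    exact ⟨ball p δ, mem_nhdsWithin_of_mem_nhds (ball_mem_nhds p hδ), δ, hδ, h⟩

/-- Unique continuation: the agreement set is relatively open, since a straightening is injective,
and relatively closed, since `F` is Hausdorff. -/
lemma Leafwise.eqOn {u v : E → F} {S : Set E} (hu : c.Leafwise u S) (hv : c.Leafwise v S)
    (hS : IsPreconnected S) {a : E} (ha : a ∈ S) (huv : u a = v a) : EqOn u v S := by
  intro x hx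
  have key := hS.induction₂ (fun x y ↦ (u x = v x ↔ u y = v y)) ?_
    (fun _ _ _ _ _ _ h h' ↦ Iff.trans h h') (fun _ _ _ _ h ↦ Iff.symm h) ha hx
  · exact key.1 huv
  intro b hb
  by_cases h : u b = v b
  · obtain ⟨hu1, i, hi, hu2⟩ := hu b hb
    obtain ⟨Ψ, hpΨ, hsub, hΨ, -⟩ := c.exists_straightening hi
    have hv2 := (hv b hb).eventually_eq (j := i) (by rwa [← h])
    have hu3 : ∀ᶠ x in 𝓝[S] b, (x, u x) ∈ Ψ.source :=
      (continuousWithinAt_id.prodMk hu1).eventually (Ψ.open_source.mem_nhds hpΨ)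
    have hv3 : ∀ᶠ x in 𝓝[S] b, (x, v x) ∈ Ψ.source :=
      (continuousWithinAt_id.prodMk (hv b hb).1).eventually
        (Ψ.open_source.mem_nhds (by simpa only [id_eq, ← h] using hpΨ))
    filter_upwards [hu2, hv2, hu3, hv3] with y h1 h2 h3 h4
    refine iff_of_true h ?_
    have : Ψ (y, u y) = Ψ (y, v y) := by rw [hΨ, hΨ, h1, h2, h]
    exact congrArg Prod.snd (Ψ.injOn h3 h4 this)
  · have : ∀ᶠ y in 𝓝[S] b, u y ≠ v y :=
      ((hu b hb).1.prodMk (hv b hb).1).eventually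
        ((isClosed_diagonal.isOpen_compl).mem_nhds (x := (u b, v b)) h)
    filter_upwards [this] with y hy
    exact iff_of_false h hy

lemma Leafwise.exists_union {u v : E → F} {S T : Set E} (hu : c.Leafwise u S)
    (hv : c.Leafwise v T) (hS : IsClosed S) (hT : IsClosed T) (hST : IsPreconnected (S ∩ T))
    {a : E} (ha : a ∈ S ∩ T) (huv : u a = v a) :
    ∃ w, c.Leafwise w (S ∪ T) ∧ EqOn w u S := by
  classical
  have heq := (hu.mono inter_subset_left).eqOn (hv.mono inter_subset_right) hST ha huv
  have hw : EqOn (S.piecewise u v) v T := by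
    intro x hx
    by_cases hxS : x ∈ S
    · rw [piecewise_eq_of_mem _ _ _ hxS]
      exact heq ⟨hxS, hx⟩
    · rw [piecewise_eq_of_notMem _ _ _ hxS]
  exact ⟨S.piecewise u v, (hu.congr (piecewise_eqOn S u v)).union (hv.congr hw) hS hT,
    piecewise_eqOn S u v⟩

/-- Leafwise functions are differentiable, with graph tangent to the leaves. -/
lemma Leafwise.exists_hasFDerivWithinAt {u : E → F} {S : Set E} (hu : c.Leafwise u S) {a : E}
    (ha : a ∈ S) : ∃ u' : E →L[ℝ] F, HasFDerivWithinAt u u' S a ∧ ∃ i, (a, u a) ∈ c.dom i ∧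
      ∀ v, fderiv ℝ (c.fn i) (a, u a) (v, u' v) = 0 := by
  obtain ⟨h1, i, hi, h2⟩ := hu a ha
  obtain ⟨Ψ, hpΨ, hsub, hΨ, A, hA, hAv⟩ := c.exists_straightening hi
  have hpt : Ψ (a, u a) = (a, c.fn i (a, u a)) := hΨ _
  have hleft : Ψ.symm (a, c.fn i (a, u a)) = (a, u a) := by rw [← hpt, Ψ.left_inv hpΨ]
  have hd : HasFDerivAt Ψ.symm (A.symm : (E × F) →L[ℝ] (E × F)) (a, c.fn i (a, u a)) := by
    rw [← hpt]
    exact Ψ.hasFDerivAt_symm (Ψ.map_source hpΨ) (by rwa [Ψ.left_inv hpΨ])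
  let u' : E →L[ℝ] F := (ContinuousLinearMap.snd ℝ E F).comp
    ((A.symm : (E × F) →L[ℝ] (E × F)).comp (ContinuousLinearMap.inl ℝ E F))
  have hd2 : HasFDerivAt (fun x ↦ (Ψ.symm (x, c.fn i (a, u a))).2) u' a := by
    refine HasFDerivAt.comp a hasFDerivAt_snd ?_
    exact HasFDerivAt.comp (f := fun x ↦ (x, c.fn i (a, u a))) a hd (hasFDerivAt_prodMk_left a _)
  refine ⟨u', hd2.hasFDerivWithinAt.congr_of_eventuallyEq ?_ ?_, i, hi, fun v ↦ ?_⟩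
  · have h3 : ∀ᶠ x in 𝓝[S] a, (x, u x) ∈ Ψ.source :=
      (continuousWithinAt_id.prodMk h1).eventually (Ψ.open_source.mem_nhds hpΨ)
    filter_upwards [h2, h3] with x hx hx3
    have := Ψ.left_inv hx3
    rw [hΨ, hx] at this
    rw [this]
  · rw [hleft]
  · have h := hAv (A.symm (v, 0))
    rw [A.apply_symm_apply, Prod.ext_iff] at h
    obtain ⟨h3, h4⟩ := h
    have : (v, u' v) = A.symm (v, 0) := Prod.ext h3 rfl
    rw [this]
    exact h4.symm

end FiniteDimensional

/-! ### Lifting a square to a leaf, and its holonomy. -/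

section Holonomy

variable {c : TransverseCocycle ι (ℝ × ℝ) F} [FiniteDimensional ℝ F] {e : F} {ε : ℝ}

/-- The leaves are `ε`-close to the kernel of `dz - x dy`. -/
def IsClose (c : TransverseCocycle ι (ℝ × ℝ) F) (e : F) (ε : ℝ) : Prop :=
  ∀ i, ∀ p ∈ c.dom i, ∀ (a : ℝ × ℝ) (b : F), fderiv ℝ (c.fn i) p (a, b) = 0 →
    ‖b - (p.1.1 * a.2) • e‖ ≤ ε * ‖a‖

/-- Along a horizontal segment `dy` vanishes, so the height has slope at most `ε` and the mean value
inequality applies. -/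
lemma Leafwise.norm_sub_le_horizontal (hc : c.IsClose e ε) {u : ℝ × ℝ → F} {S : Set (ℝ × ℝ)}
    (hu : c.Leafwise u S) {x₁ x₂ y : ℝ} (hx : x₁ ≤ x₂) (hS : ∀ x ∈ Icc x₁ x₂, (x, y) ∈ S) :
    ‖u (x₂, y) - u (x₁, y)‖ ≤ ε * (x₂ - x₁) := by
  have key : ∀ x ∈ Icc x₁ x₂, ∃ d : F, HasDerivWithinAt (fun t ↦ u (t, y)) d (Icc x₁ x₂) x ∧
      ‖d‖ ≤ ε := by
    intro x hx
    obtain ⟨u', hu', i, hi, hv⟩ := hu.exists_hasFDerivWithinAt (hS x hx)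
    refine ⟨u' (1, 0), ?_, ?_⟩
    · exact hu'.comp_hasDerivWithinAt x
        (((hasDerivAt_id x).prodMk (hasDerivAt_const x y)).hasDerivWithinAt) hS
    · simpa using hc i _ hi _ _ (hv (1, 0))
  choose! d hd hd' using key
  have := (convex_Icc x₁ x₂).norm_image_sub_le_of_norm_hasDerivWithin_le hd hd'
    (left_mem_Icc.2 hx) (right_mem_Icc.2 hx)
  rwa [Real.norm_of_nonneg (sub_nonneg.2 hx)] at this

/-- Along a vertical segment `x` is constant, so subtracting the primitive `(x * t) • e` of `x dy e`
leaves a function of slope at most `ε`. -/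
lemma Leafwise.norm_sub_le_vertical (hc : c.IsClose e ε) {u : ℝ × ℝ → F} {S : Set (ℝ × ℝ)}
    (hu : c.Leafwise u S) {x y₁ y₂ : ℝ} (hy : y₁ ≤ y₂) (hS : ∀ y ∈ Icc y₁ y₂, (x, y) ∈ S) :
    ‖u (x, y₂) - u (x, y₁) - (x * (y₂ - y₁)) • e‖ ≤ ε * (y₂ - y₁) := by
  have key : ∀ y ∈ Icc y₁ y₂, ∃ d : F,
      HasDerivWithinAt (fun t ↦ u (x, t) - (x * t) • e) d (Icc y₁ y₂) y ∧ ‖d‖ ≤ ε := by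
    intro y hy
    obtain ⟨u', hu', i, hi, hv⟩ := hu.exists_hasFDerivWithinAt (hS y hy)
    refine ⟨u' (0, 1) - (x * 1) • e, ?_, ?_⟩
    · refine (hu'.comp_hasDerivWithinAt y
        (((hasDerivAt_const y x).prodMk (hasDerivAt_id y)).hasDerivWithinAt) hS).sub ?_
      exact (((hasDerivAt_id y).const_mul x).smul_const e).hasDerivWithinAt
    · simpa using hc i _ hi _ _ (hv (0, 1))
  choose! d hd hd' using key
  have := (convex_Icc y₁ y₂).norm_image_sub_le_of_norm_hasDerivWithin_le hd hd'
    (left_mem_Icc.2 hy) (right_mem_Icc.2 hy)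
  rw [Real.norm_of_nonneg (sub_nonneg.2 hy)] at this
  convert this using 2
  rw [mul_sub, sub_smul]
  abel

/-- Continuation cell by cell. The height at the next lower left corner has drifted by at most `ε *
s`, so it stays in the compact region where leaves of uniform radius `δ` exist; consecutive cells
meet in a segment, which is connected, so the pieces glue. -/
lemma exists_leafwise_row (hc : c.IsClose e ε) (hε : 0 ≤ ε) {s r δ h : ℝ} (hh : 0 < h) (hhδ : h < δ)
    (hδ : ∀ p ∈ (Icc 0 s ×ˢ Icc 0 s) ×ˢ closedBall (0 : F) r,
      ∃ u, c.Leafwise u (ball p.1 δ) ∧ u p.1 = p.2)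
    {y : ℝ} (hy : y ∈ Icc 0 s) {z : F} (hz : ‖z‖ + ε * s ≤ r) (k : ℕ) (hk : k * h ≤ s) :
    ∃ u, c.Leafwise u (Icc 0 (k * h) ×ˢ Icc y (y + h)) ∧ u (0, y) = z := by
  have hs : 0 ≤ s := hy.1.trans hy.2
  -- The metric on `ℝ × ℝ` is the sup metric, so `h < δ` suffices.
  have hsub : ∀ x : ℝ, Icc x (x + h) ×ˢ Icc y (y + h) ⊆ ball (x, y) δ := by
    rintro x ⟨a, b⟩ ⟨⟨ha, ha'⟩, hb, hb'⟩
    simp only at ha ha' hb hb'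
    rw [mem_ball, Prod.dist_eq, max_lt_iff, Real.dist_eq, Real.dist_eq, abs_lt, abs_lt]
    refine ⟨⟨?_, ?_⟩, ?_, ?_⟩ <;> simp only <;> linarith
  induction k with
  | zero =>
    obtain ⟨u, hu, hu0⟩ := hδ ((0, y), z) ⟨⟨⟨le_rfl, hs⟩, hy⟩, by
      rw [mem_closedBall_zero_iff]; have := mul_nonneg hε hs; simp only; linarith⟩
    refine ⟨u, hu.mono (Subset.trans (prod_mono_left ?_) (hsub 0)), hu0⟩
    simpa using hh.le
  | succ k ih =>
    push_cast at hk ⊢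
    have hkh : 0 ≤ k * h := by positivity
    have hks : k * h ≤ s := by linarith
    obtain ⟨u, hu, hu0⟩ := ih hks
    have hb := hu.norm_sub_le_horizontal (x₁ := 0) (x₂ := k * h) (y := y) hc hkh
      (fun x hx ↦ ⟨hx, le_rfl, by simp only; linarith⟩)
    have hb' : ε * (k * h - 0) ≤ ε * s := by gcongr; linarith
    have hn : ‖u (k * h, y)‖ ≤ r := by
      have := norm_le_insert' (u (k * h, y)) (u (0, y))
      rw [hu0] at this hb
      linarith
    obtain ⟨v, hv, hv0⟩ := hδ ((k * h, y), u (k * h, y))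
      ⟨⟨⟨hkh, hks⟩, hy⟩, by rwa [mem_closedBall_zero_iff]⟩
    have hinter : (Icc 0 (k * h) ×ˢ Icc y (y + h)) ∩ (Icc (k * h) (k * h + h) ×ˢ Icc y (y + h))
        = {k * h} ×ˢ Icc y (y + h) := by
      rw [prod_inter_prod, Icc_inter_Icc_eq_singleton hkh (by linarith), inter_self]
    obtain ⟨w, hw, hwu⟩ := hu.exists_union (hv.mono (hsub _))
      (isClosed_Icc.prod isClosed_Icc) (isClosed_Icc.prod isClosed_Icc)
      (by rw [hinter]; exact isPreconnected_singleton.prod isPreconnected_Icc)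
      (a := (k * h, y)) (by rw [hinter]; exact ⟨rfl, le_rfl, by simp only; linarith⟩) hv0.symm
    refine ⟨w, ?_, ?_⟩
    · rwa [← union_prod, Icc_union_Icc_eq_Icc hkh (by linarith),
        show k * h + h = (k + 1) * h by ring] at hw
    · rw [hwu ⟨⟨le_rfl, hkh⟩, le_rfl, by simp only; linarith⟩, hu0]

/-- Rows are stacked along the side `x = 0`. The radius `2 * ε * s` allows a drift of `ε * s` up
that side and another `ε * s` along a row. -/
lemma exists_leafwise_square (hc : c.IsClose e ε) (hε : 0 ≤ ε) {s : ℝ} (hs : 0 < s)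
    (hcov : (Icc 0 s ×ˢ Icc 0 s) ×ˢ closedBall (0 : F) (2 * ε * s) ⊆ ⋃ i, c.dom i) :
    ∃ u, c.Leafwise u (Icc 0 s ×ˢ Icc 0 s) := by
  have : ProperSpace F := FiniteDimensional.proper ℝ F
  obtain ⟨δ, hδ0, hδ⟩ := c.exists_uniform_leafwise
    ((isCompact_Icc.prod isCompact_Icc).prod (isCompact_closedBall (0 : F) (2 * ε * s))) hcov
  obtain ⟨N, hN⟩ := exists_nat_gt (s / δ)
  have hN0 : (0 : ℝ) < N := lt_trans (by positivity) hN
  obtain ⟨h, rfl⟩ : ∃ h, s = N * h := ⟨s / N, by field_simp⟩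
  have hh : 0 < h := pos_of_mul_pos_right hs hN0.le
  have hhδ : h < δ := by
    rw [div_lt_iff₀ hδ0] at hN
    exact lt_of_mul_lt_mul_left hN hN0.le
  have hεs : 0 ≤ ε * (N * h) := mul_nonneg hε hs.le
  suffices H : ∀ k : ℕ, 1 ≤ k → k ≤ N →
      ∃ u, c.Leafwise u (Icc 0 (N * h) ×ˢ Icc 0 (k * h)) ∧ u (0, 0) = 0 by
    obtain ⟨u, hu, -⟩ := H N (by exact_mod_cast hN0) le_rfl
    exact ⟨u, hu⟩
  intro k hk
  induction k, hk using Nat.le_induction with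
  | base =>
    intro _
    obtain ⟨u, hu, hu0⟩ := exists_leafwise_row hc hε hh hhδ hδ (y := 0) ⟨le_rfl, hs.le⟩
      (z := 0) (by rw [norm_zero]; linarith) N le_rfl
    exact ⟨u, by simpa using hu, hu0⟩
  | succ k hk ih =>
    intro hkN
    obtain ⟨u, hu, hu0⟩ := ih (by omega)
    have hkh : 0 ≤ k * h := by positivity
    have hkN' : (k : ℝ) + 1 ≤ N := by exact_mod_cast hkN
    have hks : k * h ≤ N * h := by gcongr; linarith
    -- On `x = 0` the term `x dy` vanishes, so only the error `ε` contributes to the height of the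
    -- next starting point.
    have hb := hu.norm_sub_le_vertical (x := 0) (y₁ := 0) (y₂ := k * h) hc hkh
      (fun y hy ↦ ⟨⟨le_rfl, hs.le⟩, hy⟩)
    rw [hu0, zero_mul, zero_smul, sub_zero, sub_zero, sub_zero] at hb
    have hb' : ε * (k * h) ≤ ε * (N * h) := by gcongr
    obtain ⟨v, hv, hv0⟩ := exists_leafwise_row hc hε hh hhδ hδ (y := k * h) ⟨hkh, hks⟩
      (z := u (0, k * h)) (by linarith) N le_rfl
    have hinter : (Icc 0 (N * h) ×ˢ Icc 0 (k * h)) ∩ (Icc 0 (N * h) ×ˢ Icc (k * h) (k * h + h))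
        = Icc 0 (N * h) ×ˢ {k * h} := by
      rw [prod_inter_prod, Icc_inter_Icc_eq_singleton hkh (by linarith), inter_self]
    obtain ⟨w, hw, hwu⟩ := hu.exists_union hv
      (isClosed_Icc.prod isClosed_Icc) (isClosed_Icc.prod isClosed_Icc)
      (by rw [hinter]; exact isPreconnected_Icc.prod isPreconnected_singleton)
      (a := (0, k * h)) (by rw [hinter]; exact ⟨⟨le_rfl, hs.le⟩, rfl⟩) hv0.symm
    refine ⟨w, ?_, ?_⟩
    · rw [← prod_union, Icc_union_Icc_eq_Icc hkh (by linarith)] at hw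
      push_cast
      rwa [show (k + 1) * h = k * h + h by ring]
    · rw [hwu ⟨⟨le_rfl, hs.le⟩, le_rfl, hkh⟩, hu0]

/-- A foliation close to the nonintegrable distribution `dz = x dy` cannot cover a full square:
going round the square changes the height by its area. -/
lemma IsClose.le_of_covers (hc : c.IsClose e ε) (he : ‖e‖ = 1) (hε : 0 ≤ ε) {s : ℝ} (hs : 0 < s)
    (hcov : (Icc 0 s ×ˢ Icc 0 s) ×ˢ closedBall (0 : F) (2 * ε * s) ⊆ ⋃ i, c.dom i) :
    s ≤ 4 * ε := by
  obtain ⟨u, hu⟩ := exists_leafwise_square hc hε hs hcov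
  have h0 : (0 : ℝ) ∈ Icc 0 s := ⟨le_rfl, hs.le⟩
  have h1 : s ∈ Icc 0 s := ⟨hs.le, le_rfl⟩
  have a1 := hu.norm_sub_le_horizontal hc hs.le (y := 0) (fun x hx ↦ ⟨hx, h0⟩)
  have a2 := hu.norm_sub_le_horizontal hc hs.le (y := s) (fun x hx ↦ ⟨hx, h1⟩)
  have a3 := hu.norm_sub_le_vertical hc hs.le (x := 0) (fun x hx ↦ ⟨h0, hx⟩)
  have a4 := hu.norm_sub_le_vertical hc hs.le (x := s) (fun x hx ↦ ⟨h1, hx⟩)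
  -- The four height differences cancel round the boundary; only the side `x = s` contributes a main
  -- term, the area.
  have key : (s * s) • e = (u (s, s) - u (0, s)) + (u (0, s) - u (0, 0) - (0 * (s - 0)) • e)
      - (u (s, 0) - u (0, 0)) - (u (s, s) - u (s, 0) - (s * (s - 0)) • e) := by
    rw [zero_mul, zero_smul, sub_zero, sub_zero]
    abel
  have hn : ‖(s * s) • e‖ = s * s := by
    rw [norm_smul, he, mul_one, Real.norm_of_nonneg (by positivity)]
  have h2 := (norm_sub_le _ _).trans (add_le_add_left ((norm_sub_le _ _).trans
    (add_le_add_left (norm_add_le (u (s, s) - u (0, s))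
      (u (0, s) - u (0, 0) - (0 * (s - 0)) • e)) ‖u (s, 0) - u (0, 0)‖))
      ‖u (s, s) - u (s, 0) - (s * (s - 0)) • e‖)
  rw [← key, hn] at h2
  rw [sub_zero] at a1 a2 a3 a4 h2
  have : s * s ≤ s * (4 * ε) := by linarith
  exact le_of_mul_le_mul_left this hs

end Holonomy

end TransverseCocycle

/-! ### Index and nondegeneracy from a transverse pair. -/

section Signature

variable {V F : Type*} [AddCommGroup V] [Module ℝ V]
  [AddCommGroup F] [Module ℝ F] [FiniteDimensional ℝ F] {B : LinearMap.BilinMap ℝ V ℝ}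
  {σ : F →ₗ[ℝ] V} {η : V →ₗ[ℝ] F}

lemma sigNeg_eq_finrank_of_transverse [FiniteDimensional ℝ V]
    (hσ : ∀ z, z ≠ 0 → B (σ z) (σ z) < 0)
    (hη : ∀ v, v ≠ 0 → η v = 0 → 0 < B v v) :
    sigNeg (LinearMap.BilinMap.toQuadraticMap B) = Module.finrank ℝ F := by
  apply le_antisymm
  -- Upper bound: `-B` is nonpositive on `ker η`, whose codimension is at most `dim F`. The range of
  -- `σ` gives the lower bound.
  · have h1 := QuadraticForm.sigPos_add_finrank_le_of_nonpos
      (Q := -LinearMap.BilinMap.toQuadraticMap B) (V := LinearMap.ker η) (by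
        intro v hv
        rcases eq_or_ne v 0 with rfl | h
        · simp
        · simpa using (hη v h (by simpa using hv)).le)
    rw [sigPos_neg] at h1
    have h2 := LinearMap.finrank_range_add_finrank_ker η
    have h3 := Submodule.finrank_le (LinearMap.range η)
    omega
  · have hinj : Function.Injective σ := by
      rw [injective_iff_map_eq_zero]
      intro z hz
      by_contra h
      simpa [hz] using hσ z h
    rw [← LinearMap.finrank_range_of_inj hinj]
    apply le_sigNeg_of_negDef
    rintro ⟨_, z, rfl⟩ hz
    have : z ≠ 0 := by
      rintro rfl
      simp at hz
    simpa using hσ z this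

/-- The map `η ∘ σ` is bijective, so `v` is `σ z` plus an element of `ker η`. If `v` is in the
radical, that element has the same square as `σ z`; the opposite signs force both to vanish. -/
lemma eq_zero_of_transverse (hsymm : ∀ v w, B v w = B w v)
    (hσ : ∀ z, z ≠ 0 → B (σ z) (σ z) < 0) (hη : ∀ v, v ≠ 0 → η v = 0 → 0 < B v v)
    {v : V} (hv : ∀ w, B v w = 0) : v = 0 := by
  have hinj : Function.Injective (η ∘ₗ σ) := by
    rw [injective_iff_map_eq_zero]
    intro z hz
    by_contra h
    have h1 := hσ z h
    have h2 : σ z ≠ 0 := by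
      intro h0
      simp [h0] at h1
    exact absurd (hη _ h2 hz) h1.le.not_gt
  obtain ⟨z, hz⟩ := (LinearMap.injective_iff_surjective.1 hinj) (η v)
  have hz' : η (v - σ z) = 0 := by
    rw [map_sub, ← hz, LinearMap.comp_apply, sub_self]
  have h1 := hv (σ z)
  have h2 := hv (v - σ z)
  have h3 : B (v - σ z) (v - σ z) = B (σ z) (σ z) := by
    have h4 := hsymm v (σ z)
    simp only [map_sub, LinearMap.sub_apply] at h2 ⊢
    linarith
  have hz0 : z = 0 := by
    by_contra h
    have h4 := hσ z h
    have h5 : v - σ z ≠ 0 := by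
      intro h0
      rw [h0] at h3
      simp at h3
      linarith
    linarith [hη _ h5 hz']
  by_contra h
  rw [hz0, map_zero, sub_zero] at hz'
  linarith [hη v h hz', hv v]

end Signature

/-! ### Adapted frames, the contact form and the cone estimate. -/

/-- A splitting of `X` into the range of `σ : F → X` and the kernel of `π : X → F`, together with
two independent coordinates `ℓ₁`, `ℓ₂` on `ker π`. -/
structure TransverseFrame (X F : Type*) [NormedAddCommGroup X] [NormedSpace ℝ X]
    [NormedAddCommGroup F] [NormedSpace ℝ F] where
  /-- The projection to the vertical factor. -/
  π : X →L[ℝ] F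
  /-- The inclusion of the vertical factor. -/
  σ : F →L[ℝ] X
  /-- The first horizontal coordinate. -/
  ℓ₁ : X →L[ℝ] ℝ
  /-- The second horizontal coordinate. -/
  ℓ₂ : X →L[ℝ] ℝ
  /-- The first horizontal vector. -/
  e₁ : X
  /-- The second horizontal vector. -/
  e₂ : X
  π_σ : ∀ z, π (σ z) = z
  π_e₁ : π e₁ = 0
  π_e₂ : π e₂ = 0
  ℓ₁_σ : ∀ z, ℓ₁ (σ z) = 0
  ℓ₂_σ : ∀ z, ℓ₂ (σ z) = 0
  ℓ₁_e₁ : ℓ₁ e₁ = 1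
  ℓ₁_e₂ : ℓ₁ e₂ = 0
  ℓ₂_e₁ : ℓ₂ e₁ = 0
  ℓ₂_e₂ : ℓ₂ e₂ = 1

namespace TransverseFrame

section

variable {X F : Type*} [NormedAddCommGroup X] [NormedSpace ℝ X]
  [NormedAddCommGroup F] [NormedSpace ℝ F] (T : TransverseFrame X F) (e : F)

/-- The `F`-valued form `dz - x dy e` at the point `x`. -/
def contactForm (x : X) : X →L[ℝ] F := T.π - T.ℓ₁ x • T.ℓ₂.smulRight e

lemma contactForm_apply (x v : X) : T.contactForm e x v = T.π v - (T.ℓ₁ x * T.ℓ₂ v) • e := by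
  simp [contactForm, mul_smul]

lemma contDiff_contactForm {k : WithTop ℕ∞} : ContDiff ℝ k (T.contactForm e) := by
  unfold contactForm
  exact contDiff_const.sub (T.ℓ₁.contDiff.smul contDiff_const)

/-- The linear map with components `e₁`, `e₂` and `σ`. -/
def incl : (ℝ × ℝ) × F →L[ℝ] X :=
  ((ContinuousLinearMap.fst ℝ ℝ ℝ).smulRight T.e₁ +
    (ContinuousLinearMap.snd ℝ ℝ ℝ).smulRight T.e₂).coprod T.σ

lemma incl_apply (p : (ℝ × ℝ) × F) : T.incl p = p.1.1 • T.e₁ + p.1.2 • T.e₂ + T.σ p.2 := by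
  simp [incl]

lemma contactForm_incl (p q : (ℝ × ℝ) × F) :
    T.contactForm e (T.incl p) (T.incl q) = q.2 - (p.1.1 * q.1.2) • e := by
  simp [contactForm_apply, incl_apply, T.π_σ, T.π_e₁, T.π_e₂, T.ℓ₁_σ, T.ℓ₂_σ, T.ℓ₁_e₁, T.ℓ₁_e₂,
    T.ℓ₂_e₁, T.ℓ₂_e₂]

end

/-- Maximal positive and negative definite subspaces `P` and `N` are complementary because the
radical is trivial. `N` is identified with `F`, `π` projects along `P`, and two basis vectors of `P`
supply the horizontal coordinates. -/
lemma exists_adapted {X F : Type*} [NormedAddCommGroup X] [NormedSpace ℝ X]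
    [FiniteDimensional ℝ X] [NormedAddCommGroup F] [NormedSpace ℝ F] [FiniteDimensional ℝ F]
    (G : X →L[ℝ] X →L[ℝ] ℝ) (hsymm : ∀ v w, G v w = G w v)
    (hnd : ∀ v, (∀ w, G v w = 0) → v = 0)
    (hindex : sigNeg (LinearMap.BilinMap.toQuadraticMap G.toLinearMap₁₂) = Module.finrank ℝ F)
    (hdim : Module.finrank ℝ F + 2 ≤ Module.finrank ℝ X) :
    ∃ T : TransverseFrame X F, (∀ v, v ≠ 0 → T.π v = 0 → 0 < G v v) ∧
      ∀ z, z ≠ 0 → G (T.σ z) (T.σ z) < 0 := by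
  set Q := LinearMap.BilinMap.toQuadraticMap G.toLinearMap₁₂ with hQ
  have hQv : ∀ v, Q v = G v v := fun _ ↦ rfl
  obtain ⟨N, hN, hNQ⟩ := exists_finrank_eq_sigNeg_and_negDef Q
  obtain ⟨P, hP, hPQ⟩ := exists_finrank_eq_sigPos_and_posDef Q
  have hNneg : ∀ v ∈ N, v ≠ 0 → G v v < 0 := by
    intro v hv h
    simpa [hQv] using hNQ ⟨v, hv⟩ (by simpa using h)
  have hPpos : ∀ v ∈ P, v ≠ 0 → 0 < G v v := by
    intro v hv h
    simpa [hQv] using hPQ ⟨v, hv⟩ (by simpa using h)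
  have hrad : Q.radical = ⊥ := by
    rw [Submodule.eq_bot_iff]
    intro v hv
    rw [QuadraticMap.mem_radical_iff'] at hv
    refine hnd v fun w ↦ ?_
    have h1 := hv.2 w
    simp only [hQv, map_add, add_apply] at h1
    have h2 := hv.1
    rw [hQv] at h2
    linarith [hsymm v w]
  have hsum := QuadraticForm.sigPos_add_sigNeg_add_radical (Q := Q)
  rw [hrad, finrank_bot, add_zero, ← hP, ← hN] at hsum
  have hdisj : Disjoint P N := by
    rw [Submodule.disjoint_def]
    intro v hvP hvN
    by_contra h
    exact absurd (hPpos v hvP h) (hNneg v hvN h).le.not_gt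
  have hcompl : IsCompl P N := by
    refine ⟨hdisj, codisjoint_iff.2 (Submodule.eq_top_of_finrank_eq ?_)⟩
    have := Submodule.finrank_sup_add_finrank_inf_eq P N
    rw [hdisj.eq_bot, finrank_bot] at this
    omega
  let Φ := Submodule.prodEquivOfIsCompl P N hcompl
  let Ψ : N ≃ₗ[ℝ] F := LinearEquiv.ofFinrankEq N F (hN.trans hindex)
  let b := Module.finBasis ℝ P
  have hP2 : 2 ≤ Module.finrank ℝ P := by omega
  let i₁ : Fin (Module.finrank ℝ P) := ⟨0, by omega⟩
  let i₂ : Fin (Module.finrank ℝ P) := ⟨1, by omega⟩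
  have h12 : i₁ ≠ i₂ := by simp [i₁, i₂]
  have hleft : ∀ x : P, Φ.symm x = (x, 0) :=
    Submodule.prodEquivOfIsCompl_symm_apply_left P N hcompl
  have hright : ∀ x : N, Φ.symm x = (0, x) :=
    Submodule.prodEquivOfIsCompl_symm_apply_right P N hcompl
  let T : TransverseFrame X F :=
    { π := LinearMap.toContinuousLinearMap
        (Ψ.toLinearMap ∘ₗ LinearMap.snd ℝ P N ∘ₗ Φ.symm.toLinearMap)
      σ := LinearMap.toContinuousLinearMap (N.subtype ∘ₗ Ψ.symm.toLinearMap)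
      ℓ₁ := LinearMap.toContinuousLinearMap
        (b.coord i₁ ∘ₗ LinearMap.fst ℝ P N ∘ₗ Φ.symm.toLinearMap)
      ℓ₂ := LinearMap.toContinuousLinearMap
        (b.coord i₂ ∘ₗ LinearMap.fst ℝ P N ∘ₗ Φ.symm.toLinearMap)
      e₁ := b i₁
      e₂ := b i₂
      π_σ := by simp [hright]
      π_e₁ := by simp [hleft]
      π_e₂ := by simp [hleft]
      ℓ₁_σ := by simp [hright]
      ℓ₂_σ := by simp [hright]
      ℓ₁_e₁ := by simp [hleft]
      ℓ₁_e₂ := by simp [hleft, h12]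
      ℓ₂_e₁ := by simp [hleft, h12.symm]
      ℓ₂_e₂ := by simp [hleft] }
  refine ⟨T, fun v hv hπ ↦ hPpos v ?_ hv, fun z hz ↦ hNneg _ (Ψ.symm z).2 ?_⟩
  · have : (Φ.symm v).2 = 0 := Ψ.map_eq_zero_iff.1 hπ
    exact (Submodule.prodEquivOfIsCompl_symm_apply_snd_eq_zero P N hcompl).1 this
  · intro h0
    exact hz (Ψ.symm.map_eq_zero_iff.1 (Subtype.ext h0))

/-- At `p` the contact form is `π`. The sign conditions are open and, by homogeneity, need only be
checked on compact unit spheres, so they persist nearby. -/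
lemma eventually_adapted {M X F : Type*} [TopologicalSpace M] [NormedAddCommGroup X]
    [NormedSpace ℝ X] [FiniteDimensional ℝ X] [NormedAddCommGroup F] [NormedSpace ℝ F]
    [FiniteDimensional ℝ F] (T : TransverseFrame X F) (e : F) {p : M}
    {G : M → X →L[ℝ] X →L[ℝ] ℝ} (hG : ContinuousAt G p) {ξ : M → X} (hξ : ContinuousAt ξ p)
    (hξp : ξ p = 0) (hpos : ∀ v, v ≠ 0 → T.π v = 0 → 0 < G p v v)
    (hneg : ∀ z, z ≠ 0 → G p (T.σ z) (T.σ z) < 0) :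
    ∀ᶠ x in 𝓝 p, (∀ v, v ≠ 0 → T.contactForm e (ξ x) v = 0 → 0 < G x v v) ∧
      (∀ z, z ≠ 0 → G x (T.σ z) (T.σ z) < 0) ∧ ‖G x‖ ≤ ‖G p‖ + 1 := by
  have : ProperSpace X := FiniteDimensional.proper ℝ X
  have : ProperSpace F := FiniteDimensional.proper ℝ F
  have hξ' : ContinuousAt (fun x ↦ T.contactForm e (ξ x)) p :=
    ((T.contDiff_contactForm e (k := 0)).continuous.continuousAt).comp hξ
  have hGv : ∀ v, ContinuousAt (fun y : M × X ↦ G y.1 y.2 y.2) (p, v) := by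
    intro v
    have h1 : ContinuousAt (fun y : M × X ↦ G y.1) (p, v) :=
      ContinuousAt.comp (f := Prod.fst) hG continuousAt_fst
    exact (h1.clm_apply continuousAt_snd).clm_apply continuousAt_snd
  have h1 : ∀ᶠ x in 𝓝 p, ∀ v ∈ sphere (0 : X) 1,
      T.contactForm e (ξ x) v ≠ 0 ∨ 0 < G x v v := by
    apply (isCompact_sphere (0 : X) 1).eventually_forall_of_forall_eventually
    intro v hv
    by_cases h : T.π v = 0
    · have hv0 : v ≠ 0 := ne_zero_of_mem_unit_sphere ⟨v, hv⟩
      filter_upwards [(hGv v).eventually (lt_mem_nhds (hpos v hv0 h))] with y hy using Or.inr hy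
    · have h2 : ContinuousAt (fun y : M × X ↦ T.contactForm e (ξ y.1) y.2) (p, v) :=
        ContinuousAt.clm_apply (f := fun y : M × X ↦ T.contactForm e (ξ y.1))
          (ContinuousAt.comp (f := Prod.fst) (x := (p, v)) hξ' continuousAt_fst) continuousAt_snd
      have h3 : T.contactForm e (ξ p) v ≠ 0 := by simpa [contactForm_apply, hξp] using h
      filter_upwards [h2.eventually_ne h3] with y hy using Or.inl hy
  have h2 : ∀ᶠ x in 𝓝 p, ∀ z ∈ sphere (0 : F) 1, G x (T.σ z) (T.σ z) < 0 := by
    apply (isCompact_sphere (0 : F) 1).eventually_forall_of_forall_eventually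
    intro z hz
    have hz0 : z ≠ 0 := ne_zero_of_mem_unit_sphere ⟨z, hz⟩
    have h3 : ContinuousAt (fun y : M × F ↦ G y.1 (T.σ y.2) (T.σ y.2)) (p, z) :=
      ContinuousAt.comp (f := fun y : M × F ↦ (y.1, T.σ y.2)) (x := (p, z))
        (g := fun y : M × X ↦ G y.1 y.2 y.2) (hGv (T.σ z)) (by fun_prop)
    exact h3.eventually (gt_mem_nhds (hneg z hz0))
  have hnorm : Continuous fun A : X →L[ℝ] X →L[ℝ] ℝ ↦ ‖A‖ :=
    continuous_norm (E := X →L[ℝ] X →L[ℝ] ℝ)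
  have hGn : Tendsto (fun x ↦ ‖G x‖) (𝓝 p) (𝓝 ‖G p‖) := (hnorm.tendsto (G p)).comp hG
  have h3 : ∀ᶠ x in 𝓝 p, ‖G x‖ < ‖G p‖ + 1 := hGn.eventually_lt_const (lt_add_one ‖G p‖)
  filter_upwards [h1, h2, h3] with x hx1 hx2 hx3
  refine ⟨fun v hv hη ↦ ?_, fun z hz ↦ ?_, hx3.le⟩
  · have hn : 0 < ‖v‖ := norm_pos_iff.2 hv
    have := (hx1 (‖v‖⁻¹ • v) (by simp [norm_smul, hn.ne'])).resolve_left (by simp [hη])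
    simp only [map_smul, smul_apply, smul_eq_mul] at this
    exact pos_of_mul_pos_right (pos_of_mul_pos_right this (by positivity)) (by positivity)
  · have hn : 0 < ‖z‖ := norm_pos_iff.2 hz
    have := hx2 (‖z‖⁻¹ • z) (by simp [norm_smul, hn.ne'])
    simp only [map_smul, smul_apply, smul_eq_mul] at this
    rw [← mul_assoc] at this
    exact (pos_iff_neg_of_mul_neg this).1 (by positivity)

/-- If the form `‖contactForm‖²` is subtracted with a large factor, all non-timelike vectors in the
image of `incl` are close to the kernel of the contact form. -/
lemma exists_cone_bound {X F : Type*} [NormedAddCommGroup X] [NormedSpace ℝ X]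
    [NormedAddCommGroup F] [NormedSpace ℝ F] (T : TransverseFrame X F) {e : F} (he : ‖e‖ = 1)
    {C ε : ℝ} (hC : 0 ≤ C) (hε : 0 < ε) :
    ∃ Λ : ℝ, 0 ≤ Λ ∧ ∀ p q : (ℝ × ℝ) × F, |p.1.1| ≤ 1 → ∀ G : X →L[ℝ] X →L[ℝ] ℝ, ‖G‖ ≤ C →
      0 ≤ G (T.incl q) (T.incl q) - Λ * ‖T.contactForm e (T.incl p) (T.incl q)‖ ^ 2 →
      ‖q.2 - (p.1.1 * q.1.2) • e‖ ≤ ε * ‖q.1‖ := by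
  -- If the bound fails with defect `m`, then `‖q‖ ≤ m * (2 / ε + 1)`, so `G` on `T.incl q` is at
  -- most this constant without its `+ 1`, times `m ^ 2`; the `+ 1` makes the difference negative.
  refine ⟨C * ‖T.incl‖ ^ 2 * (2 / ε + 1) ^ 2 + 1, by positivity, ?_⟩
  intro p q hp G hG h
  rw [contactForm_incl] at h
  set m := ‖q.2 - (p.1.1 * q.1.2) • e‖ with hm
  have hm0 : 0 ≤ m := norm_nonneg _
  by_contra! hlt
  have hmpos : 0 < m := lt_of_le_of_lt (by positivity) hlt
  have h2 : ‖q.2‖ ≤ m + ‖q.1‖ := by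
    have h3 : ‖(p.1.1 * q.1.2) • e‖ ≤ ‖q.1‖ := by
      rw [norm_smul, he, mul_one, norm_mul, Real.norm_eq_abs]
      calc |p.1.1| * ‖q.1.2‖ ≤ 1 * ‖q.1‖ := by
            gcongr
            exact norm_snd_le q.1
        _ = ‖q.1‖ := one_mul _
    have h4 := norm_le_insert' q.2 ((p.1.1 * q.1.2) • e)
    linarith
  have h5 : ‖q.1‖ ≤ m / ε := by
    rw [le_div_iff₀ hε]
    linarith
  have h6 : ‖q‖ ≤ m * (2 / ε + 1) := by
    have h7 : m * (2 / ε + 1) = m + m / ε + m / ε := by ring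
    have h8 : 0 ≤ m / ε := by positivity
    rw [Prod.norm_def, max_le_iff]
    constructor <;> linarith
  have h9 : G (T.incl q) (T.incl q) ≤ C * ‖T.incl‖ ^ 2 * (2 / ε + 1) ^ 2 * m ^ 2 := by
    calc G (T.incl q) (T.incl q) ≤ ‖G (T.incl q) (T.incl q)‖ := le_abs_self _
      _ ≤ ‖G‖ * ‖T.incl q‖ * ‖T.incl q‖ := G.le_opNorm₂ _ _
      _ ≤ C * (‖T.incl‖ * (m * (2 / ε + 1))) * (‖T.incl‖ * (m * (2 / ε + 1))) := by
          have := (T.incl.le_opNorm q).trans (mul_le_mul_of_nonneg_left h6 (norm_nonneg _))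
          gcongr
      _ = C * ‖T.incl‖ ^ 2 * (2 / ε + 1) ^ 2 * m ^ 2 := by ring
  nlinarith [sq_pos_of_pos hmpos]

end TransverseFrame

/-! ### Bilinear forms in a chart and the change of metric. -/

lemma contDiff_flip {X Y Z : Type*} [NormedAddCommGroup X] [NormedSpace ℝ X]
    [NormedAddCommGroup Y] [NormedSpace ℝ Y] [NormedAddCommGroup Z] [NormedSpace ℝ Z]
    {k : WithTop ℕ∞} : ContDiff ℝ k (fun A : X →L[ℝ] Y →L[ℝ] Z ↦ A.flip) := by
  have h := LinearIsometryEquiv.contDiff (𝕜 := ℝ) (n := k) (E := X →L[ℝ] Y →L[ℝ] Z)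
    (F := Y →L[ℝ] X →L[ℝ] Z) (ContinuousLinearMap.flipₗᵢ ℝ X Y Z)
  exact h

section ChartForm

variable {n : ℕ} {M : Type*} [TopologicalSpace M]
  [ChartedSpace (EuclideanSpace ℝ (Fin n)) M] [IsManifold (𝓡 n) ∞ M]

local notation "𝔼" => EuclideanSpace ℝ (Fin n)

/-- The differential at `x` of the preferred chart around `p`, as an equivalence. -/
noncomputable def chartEquiv (p : M) {x : M} (hx : x ∈ (chartAt 𝔼 p).source) :
    TangentSpace (𝓡 n) x ≃L[ℝ] 𝔼 :=
  (trivializationAt 𝔼 (TangentSpace (𝓡 n)) p).continuousLinearEquivAt ℝ x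
    (by simpa using hx)

/-- The bilinear forms in the coordinates of the preferred chart around `p`. -/
noncomputable def chartForm (p : M)
    (g : (x : M) → TangentSpace (𝓡 n) x →L[ℝ] TangentSpace (𝓡 n) x →L[ℝ] ℝ) (x : M) :
    𝔼 →L[ℝ] 𝔼 →L[ℝ] ℝ :=
  (trivializationAt (𝔼 →L[ℝ] 𝔼 →L[ℝ] ℝ)
    (fun x : M ↦ TangentSpace (𝓡 n) x →L[ℝ] TangentSpace (𝓡 n) x →L[ℝ] ℝ) p ⟨x, g x⟩).2

/-- The bilinear form given by `β` in the coordinates of the preferred chart around `p`. -/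
noncomputable def formOfChart (p : M) (β : M → 𝔼 →L[ℝ] 𝔼 →L[ℝ] ℝ) (x : M) :
    TangentSpace (𝓡 n) x →L[ℝ] TangentSpace (𝓡 n) x →L[ℝ] ℝ :=
  (trivializationAt (𝔼 →L[ℝ] 𝔼 →L[ℝ] ℝ)
    (fun x : M ↦ TangentSpace (𝓡 n) x →L[ℝ] TangentSpace (𝓡 n) x →L[ℝ] ℝ) p).symm x (β x)

lemma form_eq_chartForm (p : M)
    (g : (x : M) → TangentSpace (𝓡 n) x →L[ℝ] TangentSpace (𝓡 n) x →L[ℝ] ℝ) {x : M}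
    (hx : x ∈ (chartAt 𝔼 p).source) (v w : TangentSpace (𝓡 n) x) :
    g x v w = chartForm p g x (chartEquiv p hx v) (chartEquiv p hx w) := by
  have hb : x ∈ (trivializationAt 𝔼 (TangentSpace (𝓡 n)) p).baseSet := by simpa using hx
  have h : chartForm p g x (chartEquiv p hx v) (chartEquiv p hx w) = _ :=
    inCoordinates_apply_eq₂ (E₃ := fun _ : M ↦ ℝ) (F₃ := ℝ) hb hb (by simp)
  rw [h]
  have hs : ∀ u : TangentSpace (𝓡 n) x,
      (trivializationAt 𝔼 (TangentSpace (𝓡 n)) p).symm x (chartEquiv p hx u) = u := fun u ↦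
    (chartEquiv p hx).symm_apply_apply u
  rw [hs, hs]
  simp

lemma mem_baseSet_bilin (p : M) {x : M} (hx : x ∈ (chartAt 𝔼 p).source) :
    x ∈ (trivializationAt (𝔼 →L[ℝ] 𝔼 →L[ℝ] ℝ)
      (fun x : M ↦ TangentSpace (𝓡 n) x →L[ℝ] TangentSpace (𝓡 n) x →L[ℝ] ℝ) p).baseSet := by
  simpa using hx

lemma chartForm_formOfChart (p : M) (β : M → 𝔼 →L[ℝ] 𝔼 →L[ℝ] ℝ) {x : M}
    (hx : x ∈ (chartAt 𝔼 p).source) : chartForm p (formOfChart p β) x = β x := by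
  unfold chartForm formOfChart
  rw [Bundle.Trivialization.apply_mk_symm _ (mem_baseSet_bilin p hx)]

lemma formOfChart_apply (p : M) (β : M → 𝔼 →L[ℝ] 𝔼 →L[ℝ] ℝ) {x : M}
    (hx : x ∈ (chartAt 𝔼 p).source) (v w : TangentSpace (𝓡 n) x) :
    formOfChart p β x v w = β x (chartEquiv p hx v) (chartEquiv p hx w) := by
  rw [form_eq_chartForm p _ hx, chartForm_formOfChart p β hx]

set_option synthInstance.maxHeartbeats 400000 in
lemma contMDiffOn_formOfChart (p : M) {β : M → 𝔼 →L[ℝ] 𝔼 →L[ℝ] ℝ}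
    (hβ : ContMDiffOn (𝓡 n) 𝓘(ℝ, 𝔼 →L[ℝ] 𝔼 →L[ℝ] ℝ) ∞ β (chartAt 𝔼 p).source) :
    ContMDiffOn (𝓡 n) ((𝓡 n).prod 𝓘(ℝ, 𝔼 →L[ℝ] 𝔼 →L[ℝ] ℝ)) ∞
      (fun x ↦ Bundle.TotalSpace.mk' (𝔼 →L[ℝ] 𝔼 →L[ℝ] ℝ)
        (E := fun x : M ↦ TangentSpace (𝓡 n) x →L[ℝ] TangentSpace (𝓡 n) x →L[ℝ] ℝ) x
        (formOfChart p β x)) (chartAt 𝔼 p).source := by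
  rw [Bundle.Trivialization.contMDiffOn_section_iff
    (trivializationAt (𝔼 →L[ℝ] 𝔼 →L[ℝ] ℝ)
      (fun x : M ↦ TangentSpace (𝓡 n) x →L[ℝ] TangentSpace (𝓡 n) x →L[ℝ] ℝ) p)
    (chartAt 𝔼 p).open_source (fun x hx ↦ mem_baseSet_bilin p hx)]
  exact hβ.congr fun x hx ↦ chartForm_formOfChart p β hx

set_option synthInstance.maxHeartbeats 400000 in
lemma SemiRiemannianMetric.continuousAt_chartForm {q : ℕ} (g : SemiRiemannianMetric n q M)
    (p : M) : ContinuousAt (chartForm p g.form) p := by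
  have h := g.contMDiff.contMDiffAt (x := p)
  rw [Bundle.Trivialization.contMDiffAt_section_iff
    (trivializationAt (𝔼 →L[ℝ] 𝔼 →L[ℝ] ℝ)
      (fun x : M ↦ TangentSpace (𝓡 n) x →L[ℝ] TangentSpace (𝓡 n) x →L[ℝ] ℝ) p)
    (mem_baseSet_bilin p (mem_chart_source _ p))] at h
  exact h.continuousAt

set_option synthInstance.maxHeartbeats 400000 in
set_option maxHeartbeats 1000000 in
/-- Subtracting a multiple of a positive semidefinite form that is supported in a chart. -/
lemma SemiRiemannianMetric.exists_sub_smul_sq [T2Space M] {q : ℕ} (g : SemiRiemannianMetric n q M)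
    {F : Type*} [NormedAddCommGroup F] [InnerProductSpace ℝ F] [FiniteDimensional ℝ F]
    (hF : Module.finrank ℝ F = q) {p : M} (f : SmoothBumpFunction (𝓡 n) p)
    {η : M → 𝔼 →L[ℝ] F} (hη : ContMDiffOn (𝓡 n) 𝓘(ℝ, 𝔼 →L[ℝ] F) ∞ η (chartAt 𝔼 p).source)
    (σ : F →L[ℝ] 𝔼) (hpos : ∀ x ∈ Function.support f, ∀ v, v ≠ 0 → η x v = 0 →
      0 < chartForm p g.form x v v)
    (hneg : ∀ x ∈ Function.support f, ∀ z, z ≠ 0 → chartForm p g.form x (σ z) (σ z) < 0)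
    {Λ : ℝ} (hΛ : 0 ≤ Λ) :
    ∃ g' : SemiRiemannianMetric n q M, (∀ x, f x = 0 → g'.form x = g.form x) ∧
      ∀ x (hx : x ∈ (chartAt 𝔼 p).source) (v : TangentSpace (𝓡 n) x),
        g'.form x v v = g.form x v v - Λ * f x * ‖η x (chartEquiv p hx v)‖ ^ 2 := by
  let β : M → 𝔼 →L[ℝ] 𝔼 →L[ℝ] ℝ := fun x ↦ (innerSL ℝ).bilinearComp (η x) (η x)
  have hβapp : ∀ x v w, β x v w = inner ℝ (η x v) (η x w) := fun x v w ↦ rfl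
  have hβ : ContMDiffOn (𝓡 n) 𝓘(ℝ, 𝔼 →L[ℝ] 𝔼 →L[ℝ] ℝ) ∞ β (chartAt 𝔼 p).source := by
    have h1 : ContDiff ℝ ∞ (fun A : 𝔼 →L[ℝ] F ↦ (innerSL ℝ).bilinearComp A A) :=
      contDiff_flip.comp
        ((contDiff_flip.comp (contDiff_const.clm_comp contDiff_id)).clm_comp contDiff_id)
    exact h1.contMDiff.comp_contMDiffOn hη
  let ψ : M → ℝ := fun x ↦ Λ * f x
  have hψ : ContMDiff (𝓡 n) 𝓘(ℝ) ∞ ψ := contMDiff_const.mul f.contMDiff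
  -- Support inside the chart domain lets the locally defined form extend smoothly by zero.
  have hψt : tsupport ψ ⊆ (chartAt 𝔼 p).source :=
    (closure_mono (Function.support_mul_subset_right _ _)).trans f.tsupport_subset_chartAt_source
  have hsec := ContMDiffOn.smul_section_of_tsupport (V := fun x : M ↦
    TangentSpace (𝓡 n) x →L[ℝ] TangentSpace (𝓡 n) x →L[ℝ] ℝ) hψ.contMDiffOn
    (chartAt 𝔼 p).open_source hψt (contMDiffOn_formOfChart p hβ)
  let form : (x : M) → TangentSpace (𝓡 n) x →L[ℝ] TangentSpace (𝓡 n) x →L[ℝ] ℝ :=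
    fun x ↦ g.form x - ψ x • formOfChart p β x
  have hform : ∀ x (hx : x ∈ (chartAt 𝔼 p).source) (v w : TangentSpace (𝓡 n) x),
      form x v w = g.form x v w - Λ * f x *
        inner ℝ (η x (chartEquiv p hx v)) (η x (chartEquiv p hx w)) := by
    intro x hx v w
    change g.form x v w - Λ * f x * formOfChart p β x v w = _
    rw [formOfChart_apply p β hx, hβapp]
  have hzero : ∀ x, f x = 0 → form x = g.form x := by
    intro x hx
    have : ψ x = 0 := by simp [ψ, hx]
    refine ContinuousLinearMap.ext fun v ↦ ContinuousLinearMap.ext fun w ↦ ?_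
    change g.form x v w - ψ x * formOfChart p β x v w = g.form x v w
    rw [this, zero_mul, sub_zero]
  have hsymm : ∀ x v w, form x v w = form x w v := by
    intro x v w
    by_cases hx : f x = 0
    · rw [hzero x hx, g.symm]
    · have hx' := f.support_subset_source hx
      rw [hform x hx', hform x hx', g.symm, real_inner_comm]
  -- The subtracted term is nonnegative, so vertical vectors stay negative; it vanishes on `ker η`,
  -- which stays positive (`hp`).
  have hn : ∀ x (hx : f x ≠ 0) (z : F), z ≠ 0 →
      (form x).toLinearMap₁₂ ((chartEquiv p (f.support_subset_source hx)).symm (σ z))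
        ((chartEquiv p (f.support_subset_source hx)).symm (σ z)) < 0 := by
    intro x hx z hz
    rw [ContinuousLinearMap.toLinearMap₁₂_apply_apply_apply, hform x (f.support_subset_source hx),
      form_eq_chartForm p g.form (f.support_subset_source hx),
      ContinuousLinearEquiv.apply_symm_apply]
    have h1 := hneg x hx z hz
    have h2 : 0 ≤ Λ * f x * inner ℝ (η x (σ z)) (η x (σ z)) :=
      mul_nonneg (mul_nonneg hΛ f.nonneg) real_inner_self_nonneg
    linarith
  have hp : ∀ x (hx : f x ≠ 0) (v : TangentSpace (𝓡 n) x), v ≠ 0 →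
      η x (chartEquiv p (f.support_subset_source hx) v) = 0 →
      0 < (form x).toLinearMap₁₂ v v := by
    intro x hx v hv h
    rw [ContinuousLinearMap.toLinearMap₁₂_apply_apply_apply, hform x (f.support_subset_source hx),
      h, inner_zero_left, mul_zero, sub_zero, form_eq_chartForm p g.form
        (f.support_subset_source hx)]
    exact hpos x hx _ (by simpa using hv) h
  refine ⟨⟨form, hsymm, ?_, ?_, ?_⟩, hzero, ?_⟩
  · intro x v hv
    by_cases hx : f x = 0
    · rw [hzero x hx] at hv
      exact g.nondegenerate x v hv
    · exact eq_zero_of_transverse (B := (form x).toLinearMap₁₂)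
        (σ := (chartEquiv p (f.support_subset_source hx)).symm.toLinearMap ∘ₗ σ.toLinearMap)
        (η := (η x).toLinearMap ∘ₗ (chartEquiv p (f.support_subset_source hx)).toLinearMap)
        (hsymm x) (hn x hx) (hp x hx) hv
  · intro x
    by_cases hx : f x = 0
    · rw [hzero x hx]
      exact g.index_eq x
    · have : FiniteDimensional ℝ (TangentSpace (𝓡 n) x) :=
        inferInstanceAs (FiniteDimensional ℝ 𝔼)
      rw [← hF]
      exact sigNeg_eq_finrank_of_transverse (B := (form x).toLinearMap₁₂)
        (σ := (chartEquiv p (f.support_subset_source hx)).symm.toLinearMap ∘ₗ σ.toLinearMap)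
        (η := (η x).toLinearMap ∘ₗ (chartEquiv p (f.support_subset_source hx)).toLinearMap)
        (hn x hx) (hp x hx)
  · exact g.contMDiff.sub_section hsec
  · intro x hx v
    rw [← real_inner_self_eq_norm_sq]
    exact hform x hx v v

end ChartForm

/-! ### Foliations of the manifold read in a chart. -/

/-- The last `q` coordinates of a vector of `ℝⁿ`. -/
noncomputable def lastCoords {n q : ℕ} (h : q ≤ n) :
    EuclideanSpace ℝ (Fin n) →L[ℝ] EuclideanSpace ℝ (Fin q) :=
  LinearMap.toContinuousLinearMap
    { toFun := fun y ↦ WithLp.toLp 2 fun i ↦ y ⟨n - q + i, by omega⟩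
      map_add' := fun _ _ ↦ rfl
      map_smul' := fun _ _ ↦ rfl }

lemma lastCoords_eq_iff {n q : ℕ} (h : q ≤ n) (y z : EuclideanSpace ℝ (Fin n)) :
    lastCoords h y = lastCoords h z ↔ SameSlice q y z := by
  constructor
  · intro hyz i hi
    have h1 : lastCoords h y ⟨i - (n - q), by omega⟩ = lastCoords h z ⟨i - (n - q), by omega⟩ := by
      rw [hyz]
    have h2 : (⟨n - q + (i - (n - q)), by omega⟩ : Fin n) = i := Fin.ext (by simp only; omega)
    change y ⟨n - q + (i - (n - q)), by omega⟩ = z ⟨n - q + (i - (n - q)), by omega⟩ at h1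
    rwa [h2] at h1
  · intro hyz
    ext i
    exact hyz ⟨n - q + i, by omega⟩ (by simp only; omega)

section Foliation

variable {n q : ℕ} {M : Type*} [TopologicalSpace M]
  [ChartedSpace (EuclideanSpace ℝ (Fin n)) M] [IsManifold (𝓡 n) ∞ M]

local notation "𝔼" => EuclideanSpace ℝ (Fin n)

lemma contDiffOn_comp_extChartAt_symm (p : M) {φ : OpenPartialHomeomorph M 𝔼}
    (hφ : φ ∈ IsManifold.maximalAtlas (𝓡 n) ∞ M) :
    ContDiffOn ℝ ∞ (φ ∘ (extChartAt (𝓡 n) p).symm)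
      ((extChartAt (𝓡 n) p).target ∩ (extChartAt (𝓡 n) p).symm ⁻¹' φ.source) := by
  rw [← contMDiffOn_iff_contDiffOn]
  exact (contMDiffOn_of_mem_maximalAtlas hφ).comp
    ((contMDiffOn_extChartAt_symm p).mono inter_subset_left) inter_subset_right

/-- The inverse of `chartEquiv` is the derivative of the inverse chart, so this is the chain rule.
It turns tangency to leaves into a condition on an ordinary derivative. -/
lemma mfderiv_chartEquiv_symm (p : M) {φ : OpenPartialHomeomorph M 𝔼}
    (hφ : φ ∈ IsManifold.maximalAtlas (𝓡 n) ∞ M) {y : 𝔼}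
    (hy : y ∈ (extChartAt (𝓡 n) p).target) (hyφ : (extChartAt (𝓡 n) p).symm y ∈ φ.source)
    (hx : (extChartAt (𝓡 n) p).symm y ∈ (chartAt 𝔼 p).source) (w : 𝔼) :
    mfderiv (𝓡 n) (𝓡 n) φ ((extChartAt (𝓡 n) p).symm y) ((chartEquiv p hx).symm w) =
      fderiv ℝ (φ ∘ (extChartAt (𝓡 n) p).symm) y w := by
  have h1 : MDifferentiableAt (𝓡 n) (𝓡 n) φ ((extChartAt (𝓡 n) p).symm y) :=
    ((contMDiffOn_of_mem_maximalAtlas hφ).contMDiffAt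
      (φ.open_source.mem_nhds hyφ)).mdifferentiableAt (by simp)
  have h2 : MDifferentiableAt 𝓘(ℝ, 𝔼) (𝓡 n) (extChartAt (𝓡 n) p).symm y :=
    ((contMDiffOn_extChartAt_symm (n := ∞) p).contMDiffAt
      ((isOpen_extChartAt_target p).mem_nhds hy)).mdifferentiableAt (by simp)
  rw [← mfderiv_eq_fderiv, mfderiv_comp y h1 h2]
  have h3 := TangentBundle.symmL_trivializationAt (I := 𝓡 n) hx
  rw [(extChartAt (𝓡 n) p).right_inv hy, modelWithCornersSelf_coe, range_id,
    mfderivWithin_univ] at h3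
  have h4 : (chartEquiv p hx).symm w = mfderiv 𝓘(ℝ, 𝔼) (𝓡 n) (extChartAt (𝓡 n) p).symm y w := by
    rw [← h3]
    exact congrFun (Bundle.Trivialization.symm_continuousLinearEquivAt_eq _ _) w
  rw [h4]
  rfl

/-- Pulling the transverse coordinates of the foliated charts back to the slice through `p` gives a
`TransverseCocycle`: a pulled-back kernel vector `b` is one for which `T.incl b` is tangent to a
leaf. The holonomy estimate then contradicts `4 * ε < s`. -/
lemma FoliationOn.false_of_forall_isTangent_small (hqn : q ≤ n) {U : Set M}
    (F : FoliationOn n q U) (p : M) (T : TransverseFrame 𝔼 (EuclideanSpace ℝ (Fin q)))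
    {e : EuclideanSpace ℝ (Fin q)} (he : ‖e‖ = 1) {s ε : ℝ} (hs : 0 < s) (hε : 0 ≤ ε)
    (hlt : 4 * ε < s) {Ω : Set ((ℝ × ℝ) × EuclideanSpace ℝ (Fin q))} (hΩ : IsOpen Ω)
    (hcov : (Icc 0 s ×ˢ Icc 0 s) ×ˢ closedBall 0 (2 * ε * s) ⊆ Ω)
    (hΩt : ∀ a ∈ Ω, extChartAt (𝓡 n) p p + T.incl a ∈ (extChartAt (𝓡 n) p).target)
    (hΩU : ∀ a ∈ Ω, (extChartAt (𝓡 n) p).symm (extChartAt (𝓡 n) p p + T.incl a) ∈ U)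
    (H : ∀ a ∈ Ω, ∀ hx : (extChartAt (𝓡 n) p).symm (extChartAt (𝓡 n) p p + T.incl a) ∈
      (chartAt 𝔼 p).source, ∀ b, F.IsTangent ((chartEquiv p hx).symm (T.incl b)) →
        ‖b.2 - (a.1.1 * b.1.2) • e‖ ≤ ε * ‖b.1‖) : False := by
  let J : (ℝ × ℝ) × EuclideanSpace ℝ (Fin q) → 𝔼 := fun a ↦ extChartAt (𝓡 n) p p + T.incl a
  have hJ : ContDiff ℝ 1 J := contDiff_const.add T.incl.contDiff
  have hJ' : ∀ a, HasFDerivAt J T.incl a := fun a ↦ T.incl.hasFDerivAt.const_add _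
  let ζ : (ℝ × ℝ) × EuclideanSpace ℝ (Fin q) → M := fun a ↦ (extChartAt (𝓡 n) p).symm (J a)
  have hζ : ContinuousOn ζ Ω :=
    (continuousOn_extChartAt_symm p).comp hJ.continuous.continuousOn hΩt
  have hdom : ∀ φ : F.charts, IsOpen (Ω ∩ ζ ⁻¹' φ.1.source) := fun φ ↦
    hζ.isOpen_inter_preimage hΩ φ.1.open_source
  have hfn : ∀ φ : F.charts, ContDiffOn ℝ 1
      (fun a ↦ lastCoords hqn (φ.1 (ζ a))) (Ω ∩ ζ ⁻¹' φ.1.source) := by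
    intro φ
    refine (lastCoords hqn).contDiff.comp_contDiffOn ?_
    exact ((contDiffOn_comp_extChartAt_symm p (F.mem_maximalAtlas _ φ.2)).of_le (by simp)).comp
      hJ.contDiffOn fun a ha ↦ ⟨hΩt a ha.1, ha.2⟩
  have hsmall : ∀ φ : F.charts, ∀ a ∈ Ω ∩ ζ ⁻¹' φ.1.source, ∀ b,
      fderiv ℝ (fun a ↦ lastCoords hqn (φ.1 (ζ a))) a b = 0 →
        ‖b.2 - (a.1.1 * b.1.2) • e‖ ≤ ε * ‖b.1‖ := by
    rintro φ a ⟨ha, haφ⟩ b hb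
    have hx : ζ a ∈ (chartAt 𝔼 p).source := by
      rw [← extChartAt_source (𝓡 n)]
      exact (extChartAt (𝓡 n) p).map_target (hΩt a ha)
    refine H a ha hx b ⟨φ.1, φ.2, haφ, ?_⟩
    rw [mfderiv_chartEquiv_symm p (F.mem_maximalAtlas _ φ.2) (hΩt a ha) haφ hx,
      ← lastCoords_eq_iff hqn, map_zero]
    have hd : HasFDerivAt (φ.1 ∘ (extChartAt (𝓡 n) p).symm)
        (fderiv ℝ (φ.1 ∘ (extChartAt (𝓡 n) p).symm) (J a)) (J a) := by
      refine (((contDiffOn_comp_extChartAt_symm p (F.mem_maximalAtlas _ φ.2)).contDiffAt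
        (IsOpen.mem_nhds ?_ ⟨hΩt a ha, haφ⟩)).differentiableAt (by simp)).hasFDerivAt
      exact (continuousOn_extChartAt_symm p).isOpen_inter_preimage (isOpen_extChartAt_target p)
        φ.1.open_source
    have hd' := (lastCoords hqn).hasFDerivAt.comp a (hd.comp a (hJ' a))
    rw [show (fun a ↦ lastCoords hqn (φ.1 (ζ a))) =
      lastCoords hqn ∘ (φ.1 ∘ (extChartAt (𝓡 n) p).symm) ∘ J from rfl, hd'.fderiv] at hb
    exact hb
  let c : TransverseCocycle F.charts (ℝ × ℝ) (EuclideanSpace ℝ (Fin q)) :=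
    { dom := fun φ ↦ Ω ∩ ζ ⁻¹' φ.1.source
      fn := fun φ a ↦ lastCoords hqn (φ.1 (ζ a))
      isOpen_dom := hdom
      contDiffOn := hfn
      injective_vertical := by
        intro φ a ha b hb
        -- For zero horizontal part the estimate reads `‖b‖ ≤ 0`: closeness to the contact kernel
        -- already implies transversality.
        have h := hsmall φ a ha (0, b) hb
        simpa using h
      compatible := by
        rintro φ ψ a ⟨⟨ha, haφ⟩, -, haψ⟩
        obtain ⟨W, hWo, haW, -, hW⟩ := F.compatible _ φ.2 _ ψ.2 (ζ a) ⟨haφ, haψ⟩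
        refine ⟨ζ ⁻¹' W, (hζ.continuousAt (hΩ.mem_nhds ha)).preimage_mem_nhds
          (hWo.mem_nhds haW), fun y hy z hz hyz ↦ ?_⟩
        rw [lastCoords_eq_iff] at hyz ⊢
        exact hW _ hy _ hz hyz }
  have hclose : c.IsClose e ε := fun φ a ha v w hvw ↦ hsmall φ a ha (v, w) hvw
  refine (hclose.le_of_covers he hε hs ?_).not_gt hlt
  intro a ha
  have haΩ := hcov ha
  obtain ⟨φ, hφ, haφ⟩ := F.covers _ (hΩU a haΩ)
  exact mem_iUnion.2 ⟨⟨φ, hφ⟩, haΩ, haφ⟩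

end Foliation

/-! ### Restriction of foliations to open subsets. -/

section Restrict

variable {n q : ℕ} {M : Type*} [TopologicalSpace M]
  [ChartedSpace (EuclideanSpace ℝ (Fin n)) M] {U V : Set M}

/-- The restriction of a foliation to a smaller open subset. -/
def FoliationOn.restrict (F : FoliationOn n q U) (hV : IsOpen V) (hVU : V ⊆ U) :
    FoliationOn n q V where
  charts := (fun φ ↦ φ.restrOpen V hV) '' F.charts
  mem_maximalAtlas := by
    rintro _ ⟨φ, hφ, rfl⟩
    have h : φ.restrOpen V hV = φ.restr V := by
      simp [OpenPartialHomeomorph.restr, hV.interior_eq]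
    change φ.restrOpen V hV ∈ _
    rw [h]
    exact restr_mem_maximalAtlas _ (F.mem_maximalAtlas φ hφ) hV
  source_subset := by
    rintro _ ⟨φ, hφ, rfl⟩
    exact inter_subset_right
  covers := by
    intro x hxV
    obtain ⟨φ, hφ, hx⟩ := F.covers x (hVU hxV)
    exact ⟨_, ⟨φ, hφ, rfl⟩, hx, hxV⟩
  compatible := by
    rintro _ ⟨φ, hφ, rfl⟩ _ ⟨ψ, hψ, rfl⟩ x ⟨⟨hxφ, hxV⟩, hxψ, -⟩
    obtain ⟨W, hWo, hxW, hWs, hW⟩ := F.compatible φ hφ ψ hψ x ⟨hxφ, hxψ⟩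
    refine ⟨W ∩ V, hWo.inter hV, ⟨hxW, hxV⟩, ?_, fun y hy z hz h ↦ hW y hy.1 z hz.1 h⟩
    exact fun y hy ↦ ⟨⟨(hWs hy.1).1, hy.2⟩, (hWs hy.1).2, hy.2⟩

lemma FoliationOn.IsTangent.of_restrict {F : FoliationOn n q U} {hV : IsOpen V} {hVU : V ⊆ U}
    {x : M} {v : TangentSpace (𝓡 n) x} (h : (F.restrict hV hVU).IsTangent v) : F.IsTangent v := by
  obtain ⟨_, ⟨φ, hφ, rfl⟩, hx, h⟩ := h
  exact ⟨φ, hφ, hx.1, h⟩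

end Restrict

/-! ### Construction of the metric and the main theorem. -/

section Main

variable {n q : ℕ} {M : Type*} [TopologicalSpace M]
  [ChartedSpace (EuclideanSpace ℝ (Fin n)) M] [IsManifold (𝓡 n) ∞ M]

local notation "𝔼" => EuclideanSpace ℝ (Fin n)

lemma SemiRiemannianMetric.chartForm_eq (g : SemiRiemannianMetric n q M) (p : M) {x : M}
    (hx : x ∈ (chartAt 𝔼 p).source) (v w : 𝔼) :
    chartForm p g.form x v w = g.form x ((chartEquiv p hx).symm v) ((chartEquiv p hx).symm w) := by
  rw [form_eq_chartForm p g.form hx, ContinuousLinearEquiv.apply_symm_apply,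
    ContinuousLinearEquiv.apply_symm_apply]

lemma SemiRiemannianMetric.sigNeg_chartForm (g : SemiRiemannianMetric n q M) (p : M) {x : M}
    (hx : x ∈ (chartAt 𝔼 p).source) :
    sigNeg (LinearMap.BilinMap.toQuadraticMap (chartForm p g.form x).toLinearMap₁₂) = q := by
  refine Eq.trans ?_ (g.index_eq x)
  refine QuadraticMap.Equivalent.sigNeg_eq
    ⟨{ (chartEquiv p hx).symm.toLinearEquiv with map_app' := fun v ↦ ?_ }⟩
  exact (g.chartForm_eq p hx v v).symm

lemma SemiRiemannianMetric.exists_frame (g : SemiRiemannianMetric n q M) (hqn : q + 2 ≤ n)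
    (p : M) : ∃ T : TransverseFrame 𝔼 (EuclideanSpace ℝ (Fin q)),
      (∀ v, v ≠ 0 → T.π v = 0 → 0 < chartForm p g.form p v v) ∧
      ∀ z, z ≠ 0 → chartForm p g.form p (T.σ z) (T.σ z) < 0 := by
  have hx := mem_chart_source 𝔼 p
  refine TransverseFrame.exists_adapted (chartForm p g.form p) (fun v w ↦ ?_) (fun v hv ↦ ?_) ?_ ?_
  · rw [g.chartForm_eq p hx, g.chartForm_eq p hx, g.symm]
  · have h : (chartEquiv p hx).symm v = 0 := by
      refine g.nondegenerate p _ fun w ↦ ?_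
      have := hv (chartEquiv p hx w)
      rwa [g.chartForm_eq p hx, ContinuousLinearEquiv.symm_apply_apply] at this
    simpa using h
  · rw [g.sigNeg_chartForm p hx, finrank_euclideanSpace_fin]
  · rwa [finrank_euclideanSpace_fin, finrank_euclideanSpace_fin]

lemma exists_square_subset {F : Type*} [NormedAddCommGroup F] {Ω : Set ((ℝ × ℝ) × F)}
    (hΩ : Ω ∈ 𝓝 0) : ∃ s : ℝ, 0 < s ∧ s ≤ 1 ∧ (Icc 0 s ×ˢ Icc 0 s) ×ˢ closedBall 0 s ⊆ Ω := by
  obtain ⟨r, hr, hrΩ⟩ := Metric.nhds_basis_closedBall.mem_iff.1 hΩ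
  refine ⟨min r 1, lt_min hr one_pos, min_le_right _ _, Subset.trans ?_ hrΩ⟩
  rintro ⟨⟨x, y⟩, z⟩ ⟨⟨⟨hx0, hx⟩, hy0, hy⟩, hz⟩
  have hm := min_le_left r 1
  simp only at hx0 hx hy0 hy
  rw [mem_closedBall_zero_iff] at hz ⊢
  rw [Prod.norm_def, Prod.norm_def, Real.norm_of_nonneg hx0, Real.norm_of_nonneg hy0]
  exact max_le (max_le (hx.trans hm) (hy.trans hm)) (hz.trans hm)

/-- Around every point `p` of an open set `U`, the light cones of `g` can be widened inside `U` so
much that `U` has no foliation without timelike tangent vectors. -/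
theorem SemiRiemannianMetric.exists_no_foliation [T2Space M] (g : SemiRiemannianMetric n q M)
    (hq : 1 ≤ q) (hqn : q + 2 ≤ n) {U : Set M} (hU : IsOpen U) {p : M} (hp : p ∈ U) :
    ∃ g' : SemiRiemannianMetric n q M, (∀ x ∉ U, g'.form x = g.form x) ∧
      (∀ (x : M) (v : TangentSpace (𝓡 n) x), g'.form x v v ≤ g.form x v v) ∧
      ∀ F : FoliationOn n q U, ∃ x ∈ U, ∃ v : TangentSpace (𝓡 n) x,
        F.IsTangent v ∧ g'.IsTimelike v := by
  obtain ⟨T, hpos, hneg⟩ := g.exists_frame hqn p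
  let e : EuclideanSpace ℝ (Fin q) := EuclideanSpace.single ⟨0, hq⟩ 1
  have he : ‖e‖ = 1 := by simp [e]
  let c₀ : 𝔼 := extChartAt (𝓡 n) p p
  let ξ : M → 𝔼 := fun x ↦ extChartAt (𝓡 n) p x - c₀
  have hξ : ContinuousAt ξ p := (continuousAt_extChartAt p).sub continuousAt_const
  obtain ⟨f, hf⟩ : ∃ f : SmoothBumpFunction (𝓡 n) p, tsupport f ⊆ {x | x ∈ U ∧
      (∀ v, v ≠ 0 → T.contactForm e (ξ x) v = 0 → 0 < chartForm p g.form x v v) ∧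
      (∀ z, z ≠ 0 → chartForm p g.form x (T.σ z) (T.σ z) < 0) ∧
      ‖chartForm p g.form x‖ ≤ ‖chartForm p g.form p‖ + 1} := by
    have hev := (hU.eventually_mem hp).and
      (T.eventually_adapted e (g.continuousAt_chartForm p) hξ (sub_self _) hpos hneg)
    obtain ⟨f, -, hf⟩ := (SmoothBumpFunction.nhds_basis_tsupport (I := 𝓡 n) p).mem_iff.1 hev
    exact ⟨f, hf⟩
  replace hf : ∀ x, f x ≠ 0 → _ := fun x hx ↦ hf (subset_tsupport f hx)
  let Ω : Set ((ℝ × ℝ) × EuclideanSpace ℝ (Fin q)) :=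
    -- On the ball of radius `f.rIn` the bump function is 1, so the factor `Λ` acts in full; the
    -- bound on `|a.1.1|` is needed by the cone estimate.
    {a | c₀ + T.incl a ∈ ball c₀ f.rIn ∧ |a.1.1| < 1}
  have hΩ : IsOpen Ω := by
    have h1 : Continuous fun a : (ℝ × ℝ) × EuclideanSpace ℝ (Fin q) ↦ c₀ + T.incl a := by fun_prop
    have h2 : Continuous fun a : (ℝ × ℝ) × EuclideanSpace ℝ (Fin q) ↦ |a.1.1| := by fun_prop
    exact (isOpen_ball.preimage h1).inter (isOpen_lt h2 continuous_const)
  have hΩ0 : Ω ∈ 𝓝 0 := hΩ.mem_nhds ⟨by simp [f.rIn_pos], by simp⟩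
  obtain ⟨s, hs, hs1, hsΩ⟩ := exists_square_subset hΩ0
  -- The square is fixed before `Λ`. With `ε = s / 8`, `4 * ε = s / 2 < s`, and `2 * ε * s = s ^ 2 /
  -- 4 ≤ s` because `s ≤ 1`, so the region to be covered lies in `Ω`.
  obtain ⟨Λ, hΛ, hcone⟩ := T.exists_cone_bound he (C := ‖chartForm p g.form p‖ + 1) (ε := s / 8)
    (by positivity) (by positivity)
  have hη : ContMDiffOn (𝓡 n) 𝓘(ℝ, 𝔼 →L[ℝ] EuclideanSpace ℝ (Fin q)) ∞
      (fun x ↦ T.contactForm e (ξ x)) (chartAt 𝔼 p).source :=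
    (T.contDiff_contactForm e).contMDiff.comp_contMDiffOn
      (contMDiffOn_extChartAt.sub contMDiffOn_const)
  obtain ⟨g', hg'0, hg'⟩ := g.exists_sub_smul_sq finrank_euclideanSpace_fin f hη T.σ
    (fun x hx ↦ (hf x hx).2.1) (fun x hx ↦ (hf x hx).2.2.1) hΛ
  refine ⟨g', fun x hx ↦ hg'0 x ?_, fun x v ↦ ?_, fun F ↦ ?_⟩
  · by_contra h
    exact hx (hf x h).1
  · by_cases hx : f x = 0
    · rw [hg'0 x hx]
    · rw [hg' x (f.support_subset_source hx)]
      have : 0 ≤ Λ * f x := mul_nonneg hΛ f.nonneg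
      exact sub_le_self _ (by positivity)
  · by_contra! hF
    have hΩt : ∀ a ∈ Ω, c₀ + T.incl a ∈ (extChartAt (𝓡 n) p).target := by
      intro a ha
      refine f.ball_subset ⟨ball_subset_ball f.rIn_lt_rOut.le ha.1, ?_⟩
      simp
    have hΩf : ∀ a ∈ Ω, f ((extChartAt (𝓡 n) p).symm (c₀ + T.incl a)) = 1 := by
      intro a ha
      refine f.one_of_dist_le ?_ ?_
      · rw [← extChartAt_source (𝓡 n)]
        exact (extChartAt (𝓡 n) p).map_target (hΩt a ha)
      · rw [(extChartAt (𝓡 n) p).right_inv (hΩt a ha)]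
        exact (mem_ball.1 ha.1).le
    have hΩU : ∀ a ∈ Ω, (extChartAt (𝓡 n) p).symm (c₀ + T.incl a) ∈ U := fun a ha ↦
      (hf _ (by rw [hΩf a ha]; exact one_ne_zero)).1
    refine F.false_of_forall_isTangent_small (by omega) p T he hs (ε := s / 8) (by positivity)
      (by linarith) hΩ (Subset.trans (prod_mono_right (closedBall_subset_closedBall ?_)) hsΩ)
      hΩt hΩU fun a ha hx b hb ↦ ?_
    · nlinarith
    · have h1 := hF _ (hΩU a ha) _ hb
      rw [IsTimelike, not_lt, hg' _ hx, hΩf a ha, mul_one, ← g.chartForm_eq p hx,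
        ContinuousLinearEquiv.apply_symm_apply] at h1
      have h2 : ξ ((extChartAt (𝓡 n) p).symm (c₀ + T.incl a)) = T.incl a := by
        simp only [ξ]
        rw [(extChartAt (𝓡 n) p).right_inv (hΩt a ha), add_sub_cancel_left]
      rw [h2] at h1
      exact hcone a b ha.2.le _ (hf _ (by rw [hΩf a ha]; exact one_ne_zero)).2.2.2 h1

end Main

theorem theorem0p1 {n q : ℕ} (hq : 1 ≤ q) (hqn : q + 2 ≤ n)
    {M : Type*} [TopologicalSpace M] [T2Space M]
    [ChartedSpace (EuclideanSpace ℝ (Fin n)) M] [IsManifold (𝓡 n) ∞ M]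
    (g : SemiRiemannianMetric n q M) (A : Set M) (hA : IsClosed A) (hAne : A ≠ Set.univ) :
    ∃ g' : SemiRiemannianMetric n q M,
      (∀ x ∈ A, g'.form x = g.form x) ∧
      (∀ (x : M) (v : TangentSpace (𝓡 n) x), g.IsTimelike v → g'.IsTimelike v) ∧
      (¬ ∃ F : FoliationOn n q Aᶜ,
        ∀ x ∈ Aᶜ, ∀ v : TangentSpace (𝓡 n) x, F.IsTangent v → ¬ g'.IsTimelike v) ∧
      (¬ ∃ F : FoliationOn n q (Set.univ : Set M), g'.IsSpaceFoliation F) := by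
  obtain ⟨p, hp⟩ := (ne_univ_iff_exists_notMem A).1 hAne
  obtain ⟨g', h1, h2, h3⟩ := g.exists_no_foliation hq hqn hA.isOpen_compl hp
  refine ⟨g', fun x hx ↦ h1 x (not_not_intro hx), fun x v hv ↦ (h2 x v).trans_lt hv, ?_, ?_⟩
  · rintro ⟨F, hF⟩
    obtain ⟨x, hx, v, hv, hv'⟩ := h3 F
    exact hF x hx v hv hv'
  · rintro ⟨F, hF⟩
    -- A space foliation of `M` restricts to the complement of `A`, where some leaf has a timelike,
    -- hence nonzero, tangent vector.
    obtain ⟨x, hx, v, hv, hv'⟩ := h3 (F.restrict hA.isOpen_compl (subset_univ _))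
    rw [SemiRiemannianMetric.IsTimelike] at hv'
    have hv0 : v ≠ 0 := by
      rintro rfl
      simp at hv'
    exact lt_asymm hv' (hF x v hv.of_restrict hv0)
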